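/- **Setting.** One sample is a pair of qubits $A\otimes B=\mathbb C^2\otimes\mathbb C^2$, with orthonormal basis $$|\phi^0\rangle=\tfrac1{\sqrt2}(|00\rangle+|11\rangle),\quad |\phi^1\rangle=\tfrac{\sqrt{-1}}{\sqrt2}(|01\rangle+|10\rangle),\quad |\phi^2\rangle=\tfrac1{\sqrt2}(-|01\rangle+|10\rangle),\quad |\phi^3\rangle=\tfrac{\sqrt{-1}}{\sqrt2}(|00\rangle-|11\rangle).$$ Two independent samples of an unknown state $\sigma$ are given, that is, the state $\sigma^{\otimes2}$ on $A_1\otimes B_1\otimes A_2\otimes B_2$. Write $e^{ij}=\phi^i\otimes\phi^j$ (first sample, second sample). Let $K_6^+$ and $K_3^-$ be the orthogonal projections onto the symmetric and the alternating part of $\mathrm{span}\{e^{ij}:1\le i,j\le3\}$, let $K_1^+$ be the projection onto the line spanned by $e^{11}+e^{22}+e^{33}$, put $K_5^+=K_6^+-K_1^+$, and let $L_3^\pm$ be the projection onto $\mathrm{span}\{e^{0i}\pm e^{i0}:1\le i\le3\}$. Put $$T_0^V=\tfrac1{10}K_5^++\tfrac13L_3^++(|\phi^0\rangle\langle\phi^0|)^{\otimes2}+\tfrac16K_3^-+\tfrac13L_3^-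 .$$ **Tests.** A test is a two-outcome measurement $(T_0,I-T_0)$ with $0\le T_0\le I$ for the null hypothesis $\sigma=|\phi^0\rangle\langle\phi^0|$, which is accepted on the outcome $T_0$. Consider the class $\mathcal C$ of tests that are * AB-local and samplewise-local: $(T_0,I-T_0)$ is realized by a finite protocol of local operations on each of the four single qubits $A_1,B_1,A_2,B_2$ and classical communication among them; * V-invariant: $V(g)^\dagger T_0V(g)=T_0$ for all $g\in SU(2)$, where $V(g)=g\otimes\bar g\otimes g\otimes\bar g$ on $A_1\otimes B_1\otimes A_2\otimes B_2$, with $\bar g$ the entrywise complex conjugate; * (weakly) AB-invariant: $F^\dagger T_0F=T_0$ for the simultaneous AB-transposition $F:|i\rangle_{A_1}|j\rangle_{B_1}|k\rangle_{A_2}|l\rangle_{B_2}\mapsto(-1)^{i+j+k+l}|1-j\rangle_{A_1}|1-i\rangle_{B_1}|1-l\rangle_{A_2}|1-k\rangle_{B_2}$; * of level zero: $\mathrm{Tr}\big((|\phi^0\rangle\langle\phi^0|)^{\otimes2}(I-T_0)\big)=0$. **State set.** For real $\vartheta$ let $\mathcal S(\vartheta)$ be the set of density operators $\sigma$ on $A\otimes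 B$ with $$\langle\phi^0|\sigma|\phi^0\rangle\ge\vartheta\quad\text{and}\quad 3\,\mathrm{Tr}(\sigma^{\otimes2}K_1^+)\ge\mathrm{Tr}(\sigma^{\otimes2}K_3^-).$$ **Theorem.** There is $\theta_0<1$ such that $T_0^V$ is uniformly most powerful in the class $\mathcal C$ on $\mathcal S(\theta_0)$: $T_0^V$ belongs to $\mathcal C$, and for every $\sigma\in\mathcal S(\theta_0)$ with $\sigma\neq|\phi^0\rangle\langle\phi^0|$ and every test $T_0\in\mathcal C$, $$\mathrm{Tr}(\sigma^{\otimes2}T_0^V)\le\mathrm{Tr}(\sigma^{\otimes2}T_0).$$ Moreover, $T_0^V$ is invariant under exchanging the two samples. -/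

import Mathlib

open scoped Matrix Kronecker ComplexOrder

noncomputable section

namespace LOCCDetection

/-! ### One sample: the two-qubit system `A ⊗ B` -/

/-- Index of the standard basis `|i⟩_A |j⟩_B` of one sample. -/
abbrev Pair : Type := Fin 2 × Fin 2

/-- Index of the standard basis `|i⟩_{A₁} |j⟩_{B₁} |k⟩_{A₂} |l⟩_{B₂}` of two samples. -/
abbrev TwoPairs : Type := Pair × Pair

/-- The standard basis vector `|i⟩_A ⊗ |j⟩_B`. -/
def ket (i j : Fin 2) : Pair → ℂ := Pi.single (i, j) 1

/-- The orthonormal basis `φ⁰, φ¹, φ², φ³` of the two-qubit space; `φ⁰` is the maximally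
entangled state to be detected. -/
def bell : Fin 4 → Pair → ℂ :=
  ![((Real.sqrt 2 : ℝ) : ℂ)⁻¹ • (ket 0 0 + ket 1 1),
    (Complex.I / ((Real.sqrt 2 : ℝ) : ℂ)) • (ket 0 1 + ket 1 0),
    ((Real.sqrt 2 : ℝ) : ℂ)⁻¹ • (-ket 0 1 + ket 1 0),
    (Complex.I / ((Real.sqrt 2 : ℝ) : ℂ)) • (ket 0 0 - ket 1 1)]

/-- The rank-one operator `|v⟩⟨v|`. -/
def ketbra {ι : Type*} (v : ι → ℂ) : Matrix ι ι ℂ := Matrix.vecMulVec v (star v)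

/-- `σ` is a density operator. -/
def IsDensity {ι : Type*} [Fintype ι] (σ : Matrix ι ι ℂ) : Prop :=
  σ.PosSemidef ∧ σ.trace = 1

/-! ### Two samples: the projections -/

/-- The product vector `e^{ij} = φ^i ⊗ φ^j` (first sample, second sample). -/
def e (i j : Fin 4) : TwoPairs → ℂ := fun p => bell i p.1 * bell j p.2

/-- The unit vector `(e^{ij} + e^{ji}) / √2` (for `i ≠ j`). -/
def eSym (i j : Fin 4) : TwoPairs → ℂ := ((Real.sqrt 2 : ℝ) : ℂ)⁻¹ • (e i j + e j i)

/-- The unit vector `(e^{ij} - e^{ji}) / √2` (for `i ≠ j`). -/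
def eAlt (i j : Fin 4) : TwoPairs → ℂ := ((Real.sqrt 2 : ℝ) : ℂ)⁻¹ • (e i j - e j i)

/-- Projection onto `K₆⁺`, the symmetric span of `e^{ij}`, `1 ≤ i, j ≤ 3`. -/
def K6plus : Matrix TwoPairs TwoPairs ℂ :=
  ketbra (e 1 1) + ketbra (e 2 2) + ketbra (e 3 3)
    + ketbra (eSym 1 2) + ketbra (eSym 2 3) + ketbra (eSym 1 3)

/-- Projection onto `K₁⁺`, the line spanned by `e^{11} + e^{22} + e^{33}`. -/
def K1plus : Matrix TwoPairs TwoPairs ℂ :=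
  ketbra (((Real.sqrt 3 : ℝ) : ℂ)⁻¹ • (e 1 1 + e 2 2 + e 3 3))

/-- Projection onto `K₅⁺`, the orthogonal complement of `K₁⁺` in `K₆⁺`. -/
def K5plus : Matrix TwoPairs TwoPairs ℂ := K6plus - K1plus

/-- Projection onto `K₃⁻`, the alternating span of `e^{ij}`, `1 ≤ i, j ≤ 3`. -/
def K3minus : Matrix TwoPairs TwoPairs ℂ :=
  ketbra (eAlt 1 2) + ketbra (eAlt 2 3) + ketbra (eAlt 1 3)

/-- Projection onto `L₃⁺`, spanned by `e^{0i} + e^{i0}`, `1 ≤ i ≤ 3`. -/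
def L3plus : Matrix TwoPairs TwoPairs ℂ :=
  ketbra (eSym 0 1) + ketbra (eSym 0 2) + ketbra (eSym 0 3)

/-- Projection onto `L₃⁻`, spanned by `e^{0i} - e^{i0}`, `1 ≤ i ≤ 3`. -/
def L3minus : Matrix TwoPairs TwoPairs ℂ :=
  ketbra (eAlt 0 1) + ketbra (eAlt 0 2) + ketbra (eAlt 0 3)

/-- The test `T₀^V = (1/10) K₅⁺ + (1/3) L₃⁺ + (|φ⁰⟩⟨φ⁰|)^{⊗2} + (1/6) K₃⁻ + (1/3) L₃⁻`. -/
def TV : Matrix TwoPairs TwoPairs ℂ :=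
  (1 / 10 : ℂ) • K5plus + (1 / 3 : ℂ) • L3plus + ketbra (bell 0) ⊗ₖ ketbra (bell 0)
    + (1 / 6 : ℂ) • K3minus + (1 / 3 : ℂ) • L3minus

/-! ### Locality -/

/-- Operators from `ℂ^a ⊗ ℂ^b ⊗ ℂ^c ⊗ ℂ^d` (systems `A₁, B₁, A₂, B₂`) to a space of the same
form. -/
abbrev Op (a' b' c' d' a b c d : ℕ) : Type :=
  Matrix ((Fin a' × Fin b') × (Fin c' × Fin d')) ((Fin a × Fin b) × (Fin c × Fin d)) ℂ

/-- The operator `Rᴴ S R`: the effect `S` preceded by the Kraus operator `R`. -/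
def pullback {m n : Type*} [Fintype m] (R : Matrix m n ℂ) (S : Matrix m m ℂ) : Matrix n n ℂ :=
  Rᴴ * S * R

/-- `K ⊗ 1 ⊗ 1 ⊗ 1`, for `K` acting on `A₁`. -/
def onA₁ {a a' : ℕ} (b c d : ℕ) (K : Matrix (Fin a') (Fin a) ℂ) : Op a' b c d a b c d :=
  (K ⊗ₖ (1 : Matrix (Fin b) (Fin b) ℂ)) ⊗ₖ (1 : Matrix (Fin c × Fin d) (Fin c × Fin d) ℂ)

/-- `1 ⊗ K ⊗ 1 ⊗ 1`, for `K` acting on `B₁`. -/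
def onB₁ {b b' : ℕ} (a c d : ℕ) (K : Matrix (Fin b') (Fin b) ℂ) : Op a b' c d a b c d :=
  ((1 : Matrix (Fin a) (Fin a) ℂ) ⊗ₖ K) ⊗ₖ (1 : Matrix (Fin c × Fin d) (Fin c × Fin d) ℂ)

/-- `1 ⊗ 1 ⊗ K ⊗ 1`, for `K` acting on `A₂`. -/
def onA₂ {c c' : ℕ} (a b d : ℕ) (K : Matrix (Fin c') (Fin c) ℂ) : Op a b c' d a b c d :=
  (1 : Matrix (Fin a × Fin b) (Fin a × Fin b) ℂ) ⊗ₖ (K ⊗ₖ (1 : Matrix (Fin d) (Fin d) ℂ))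

/-- `1 ⊗ 1 ⊗ 1 ⊗ K`, for `K` acting on `B₂`. -/
def onB₂ {d d' : ℕ} (a b c : ℕ) (K : Matrix (Fin d') (Fin d) ℂ) : Op a b c d' a b c d :=
  (1 : Matrix (Fin a × Fin b) (Fin a × Fin b) ℂ) ⊗ₖ ((1 : Matrix (Fin c) (Fin c) ℂ) ⊗ₖ K)

/-- `LOCC a b c d T₀ T₁`: the two-outcome measurement `(T₀, T₁)` on
`ℂ^a ⊗ ℂ^b ⊗ ℂ^c ⊗ ℂ^d` is realized by local operations on each of the four systems
`A₁, B₁, A₂, B₂` and classical communication among all of them.  Either the decision is announced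
at once (`accept`, `reject`), or one of the four systems undergoes a local measurement with Kraus
operators `K i`, the outcome `i` is broadcast, and an LOCC measurement that may depend on `i`
follows.  The dimension of a local system may change in a round, which accounts for local
ancillas; trivial measurements with `K i = √(p i) • 1` account for shared randomness. -/
inductive LOCC : (a b c d : ℕ) → Op a b c d a b c d → Op a b c d a b c d → Prop
  | accept (a b c d : ℕ) : LOCC a b c d 1 0
  | reject (a b c d : ℕ) : LOCC a b c d 0 1
  | roundA₁ {a b c d a' n : ℕ} (K : Fin n → Matrix (Fin a') (Fin a) ℂ)
      (hK : ∑ i, (K i)ᴴ * K i = 1) (S₀ S₁ : Fin n → Op a' b c d a' b c d)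
      (h : ∀ i, LOCC a' b c d (S₀ i) (S₁ i)) :
      LOCC a b c d (∑ i, pullback (onA₁ b c d (K i)) (S₀ i))
        (∑ i, pullback (onA₁ b c d (K i)) (S₁ i))
  | roundB₁ {a b c d b' n : ℕ} (K : Fin n → Matrix (Fin b') (Fin b) ℂ)
      (hK : ∑ i, (K i)ᴴ * K i = 1) (S₀ S₁ : Fin n → Op a b' c d a b' c d)
      (h : ∀ i, LOCC a b' c d (S₀ i) (S₁ i)) :
      LOCC a b c d (∑ i, pullback (onB₁ a c d (K i)) (S₀ i))
        (∑ i, pullback (onB₁ a c d (K i)) (S₁ i))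
  | roundA₂ {a b c d c' n : ℕ} (K : Fin n → Matrix (Fin c') (Fin c) ℂ)
      (hK : ∑ i, (K i)ᴴ * K i = 1) (S₀ S₁ : Fin n → Op a b c' d a b c' d)
      (h : ∀ i, LOCC a b c' d (S₀ i) (S₁ i)) :
      LOCC a b c d (∑ i, pullback (onA₂ a b d (K i)) (S₀ i))
        (∑ i, pullback (onA₂ a b d (K i)) (S₁ i))
  | roundB₂ {a b c d d' n : ℕ} (K : Fin n → Matrix (Fin d') (Fin d) ℂ)
      (hK : ∑ i, (K i)ᴴ * K i = 1) (S₀ S₁ : Fin n → Op a b c d' a b c d')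
      (h : ∀ i, LOCC a b c d' (S₀ i) (S₁ i)) :
      LOCC a b c d (∑ i, pullback (onB₂ a b c (K i)) (S₀ i))
        (∑ i, pullback (onB₂ a b c (K i)) (S₁ i))

/-- The test `(T₀, I - T₀)` is AB-local and samplewise-local: it is realized by LOCC among the four
qubits `A₁, B₁, A₂, B₂`. -/
def IsLocal (T₀ : Matrix TwoPairs TwoPairs ℂ) : Prop := LOCC 2 2 2 2 T₀ (1 - T₀)

/-! ### Invariance -/

/-- `V(g) = g ⊗ ḡ ⊗ g ⊗ ḡ` on `A₁ ⊗ B₁ ⊗ A₂ ⊗ B₂`, with `ḡ` the entrywise conjugate. -/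
def V (g : Matrix (Fin 2) (Fin 2) ℂ) : Matrix TwoPairs TwoPairs ℂ :=
  (g ⊗ₖ g.map star) ⊗ₖ (g ⊗ₖ g.map star)

/-- Invariance under the V-action of `SU(2)`. -/
def IsVInvariant (T₀ : Matrix TwoPairs TwoPairs ℂ) : Prop :=
  ∀ g ∈ Matrix.specialUnitaryGroup (Fin 2) ℂ, (V g)ᴴ * T₀ * V g = T₀

/-- The AB-transposition, acting on both samples simultaneously:
`|i⟩|j⟩|k⟩|l⟩ ↦ (-1)^{i+j+k+l} |1-j⟩|1-i⟩|1-l⟩|1-k⟩`. -/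
def abTransposition : Matrix TwoPairs TwoPairs ℂ := Matrix.of fun p q =>
  if p = ((1 - q.1.2, 1 - q.1.1), (1 - q.2.2, 1 - q.2.1)) then
    (-1) ^ (q.1.1.val + q.1.2.val + q.2.1.val + q.2.2.val)
  else 0

/-- Invariance under the simultaneous AB-transposition. -/
def IsABInvariant (T₀ : Matrix TwoPairs TwoPairs ℂ) : Prop :=
  abTranspositionᴴ * T₀ * abTransposition = T₀

/-- Invariance under exchanging the two samples. -/
def IsExchangeInvariant (T₀ : Matrix TwoPairs TwoPairs ℂ) : Prop :=
  T₀.submatrix Prod.swap Prod.swap = T₀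

/-! ### Hypothesis testing -/

/-- `T₀` is (the accepting element of) a test `(T₀, I - T₀)`. -/
def IsTest (T₀ : Matrix TwoPairs TwoPairs ℂ) : Prop :=
  T₀.PosSemidef ∧ (1 - T₀).PosSemidef

/-- The type 1 error probability `Tr(ρ T₁)`, with `T₁ = I - T₀`. -/
def typeOneError (T₀ ρ : Matrix TwoPairs TwoPairs ℂ) : ℝ := (ρ * (1 - T₀)).trace.re

/-- The type 2 error probability `Tr(ρ T₀)`. -/
def typeTwoError (T₀ ρ : Matrix TwoPairs TwoPairs ℂ) : ℝ := (ρ * T₀).trace.re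

/-- Level zero for the null hypothesis `σ = |φ⁰⟩⟨φ⁰|`. -/
def IsLevelZero (T₀ : Matrix TwoPairs TwoPairs ℂ) : Prop :=
  typeOneError T₀ (ketbra (bell 0) ⊗ₖ ketbra (bell 0)) ≤ 0

/-- `T₀` is uniformly most powerful, among the tests with property `C`, for the alternatives
`σ ∈ S₁` given as two independent samples `σ ⊗ σ`. -/
def IsUMP (C : Matrix TwoPairs TwoPairs ℂ → Prop) (S₁ : Set (Matrix Pair Pair ℂ))
    (T₀ : Matrix TwoPairs TwoPairs ℂ) : Prop :=
  C T₀ ∧ ∀ σ ∈ S₁, ∀ T₀', C T₀' → typeTwoError T₀ (σ ⊗ₖ σ) ≤ typeTwoError T₀' (σ ⊗ₖ σ)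

/-- The state set `S(ϑ)`: density operators `σ` with `⟨φ⁰|σ|φ⁰⟩ ≥ ϑ` and
`3 Tr(σ^{⊗2} K₁⁺) ≥ Tr(σ^{⊗2} K₃⁻)`. -/
def stateSet (ϑ : ℝ) : Set (Matrix Pair Pair ℂ) :=
  {σ | IsDensity σ ∧ ϑ ≤ (star (bell 0) ⬝ᵥ (σ *ᵥ bell 0)).re ∧
    ((σ ⊗ₖ σ) * K3minus).trace.re ≤ 3 * ((σ ⊗ₖ σ) * K1plus).trace.re}

/-- AB-local, samplewise-local, V-invariant, AB-invariant level-zero tests. -/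
structure IsAdmissible (T₀ : Matrix TwoPairs TwoPairs ℂ) : Prop where
  isTest : IsTest T₀
  isLocal : IsLocal T₀
  vInvariant : IsVInvariant T₀
  abInvariant : IsABInvariant T₀
  levelZero : IsLevelZero T₀

end LOCCDetection

end

/-!
In the Bell basis the group `g ⊗ ḡ` fixes `φ⁰` and rotates `φ¹, φ², φ³`, so an operator with the
required invariances is, on `span {e^{ij} : 1 ≤ i, j ≤ 3}`, an isotropic tensor
`κ₁ δ_{ij} δ_{kl} + κ₂ δ_{ik} δ_{jl} + κ₃ δ_{il} δ_{jk}`, is scalar on `span {e^{0i}}` and on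
`span {e^{i0}}`, and has no other entries except the diagonal one at `e^{00}`, those between `e^{00}`
and `e^{ii}`, and those between `e^{0i}` and `e^{i0}` (`IsIsotropic`, `IsIsotropic.trace_mul`). Only finitely many group elements are needed.

*Optimality.* The effects `T₀` and `1 - T₀` of a local test are sums of rank-one operators along
product vectors (`LOCC.mem_separable`). At level zero every product vector of `1 - T₀` has a factor
orthogonal to `φ⁰`, which kills the remaining off-diagonal entries of `T₀`
(`eq_zero_of_mem_separable`). A product vector of one sample has Bell components `X` with
`∑ Xᵢ² = 0`; hence its weight on `φ⁰` is at most its weight on the complement, and its direction in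
the complement is real up to an error controlled by the difference of the two weights. Summing over
the product vectors of `T₀` bounds the isotropic coefficients below in terms of one parameter `q`
and of the excess `δ` of the weight of `T₀` on `e^{0i}, e^{i0}` over its minimum
(`sepBound_of_mem_separable`). With `p = 1 - ⟨φ⁰|σ|φ⁰⟩`, the excess costs a multiple of
`δ p (1 - p)` and gains at most a multiple of `δ p²`, so it does not pay if `p ≤ 2 / 3`; the
condition on `K₁⁺` and `K₃⁻` says that increasing `q` from `0` does not pay either
(`optimality_bound`). This gives the threshold `θ₀ = 1 / 3`.

*Attainment.* `T₀^V` corresponds to `q = δ = 0`: both qubits of the first sample are measured along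
an axis, those of the second along a random orthogonal axis, and the test accepts if the outcomes
agree within each sample. Since only moments of order two in each axis matter, the uniformly random
pair of orthogonal axes can be replaced by a design of twelve pairs (`TV_eq_sum`), which makes the
protocol finite.
-/

noncomputable section

namespace LOCCDetection

/-! ### LOCC measurements have separable effects -/

/-- The product vector `x ⊗ y ⊗ z ⊗ u`. -/
def prodVec {a b c d : ℕ} (x : Fin a → ℂ) (y : Fin b → ℂ) (z : Fin c → ℂ) (u : Fin d → ℂ) :
    (Fin a × Fin b) × (Fin c × Fin d) → ℂ :=
  fun p => (x p.1.1 * y p.1.2) * (z p.2.1 * u p.2.2)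

/-- The cone of fully separable positive operators: finite sums of rank-one operators along
product vectors. The vectors are not normalised, so no weights are needed. -/
def separable (a b c d : ℕ) : AddSubmonoid (Op a b c d a b c d) :=
  AddSubmonoid.closure {M | ∃ x y z u, M = ketbra (prodVec x y z u)}

lemma ketbra_prodVec_mem {a b c d : ℕ} (x : Fin a → ℂ) (y : Fin b → ℂ) (z : Fin c → ℂ)
    (u : Fin d → ℂ) : ketbra (prodVec x y z u) ∈ separable a b c d :=
  AddSubmonoid.subset_closure ⟨x, y, z, u, rfl⟩

lemma pullback_ketbra {m n : Type*} [Fintype m] (R : Matrix m n ℂ) (v : m → ℂ) :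
    pullback R (ketbra v) = ketbra (Rᴴ *ᵥ v) := by
  rw [pullback, ketbra, ketbra, Matrix.mul_vecMulVec, Matrix.vecMulVec_mul, Matrix.star_mulVec,
    Matrix.conjTranspose_conjTranspose]

lemma pullback_zero {m n : Type*} [Fintype m] (R : Matrix m n ℂ) : pullback R 0 = 0 := by
  simp [pullback]

lemma pullback_add {m n : Type*} [Fintype m] (R : Matrix m n ℂ) (S T : Matrix m m ℂ) :
    pullback R (S + T) = pullback R S + pullback R T := by
  simp [pullback, Matrix.mul_add, Matrix.add_mul]

lemma pullback_sum {m n ι : Type*} [Fintype m] (R : Matrix m n ℂ) (s : Finset ι)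
    (S : ι → Matrix m m ℂ) : pullback R (∑ i ∈ s, S i) = ∑ i ∈ s, pullback R (S i) := by
  simp [pullback, Matrix.mul_sum, Matrix.sum_mul]

lemma pullback_smul {m n : Type*} [Fintype m] (R : Matrix m n ℂ) (r : ℂ) (S : Matrix m m ℂ) :
    pullback R (r • S) = r • pullback R S := by
  simp [pullback]

lemma onA₁_conjTranspose_mulVec {a a' b c d : ℕ} (K : Matrix (Fin a') (Fin a) ℂ)
    (x : Fin a' → ℂ) (y : Fin b → ℂ) (z : Fin c → ℂ) (u : Fin d → ℂ) :
    (onA₁ b c d K)ᴴ *ᵥ prodVec x y z u = prodVec (Kᴴ *ᵥ x) y z u := by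
  ext p
  simp only [onA₁, prodVec, Matrix.mulVec, dotProduct, Matrix.conjTranspose_kronecker,
    Matrix.conjTranspose_one, Matrix.kroneckerMap_apply, Fintype.sum_prod_type, Matrix.one_apply,
    Finset.sum_mul, Prod.ext_iff]
  simp [ite_and, mul_assoc]

lemma onB₁_conjTranspose_mulVec {a b b' c d : ℕ} (K : Matrix (Fin b') (Fin b) ℂ)
    (x : Fin a → ℂ) (y : Fin b' → ℂ) (z : Fin c → ℂ) (u : Fin d → ℂ) :
    (onB₁ a c d K)ᴴ *ᵥ prodVec x y z u = prodVec x (Kᴴ *ᵥ y) z u := by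
  ext p
  simp only [onB₁, prodVec, Matrix.mulVec, dotProduct, Matrix.conjTranspose_kronecker,
    Matrix.conjTranspose_one, Matrix.kroneckerMap_apply, Fintype.sum_prod_type, Matrix.one_apply,
    Finset.sum_mul, Finset.mul_sum, Prod.ext_iff]
  simp [ite_and, mul_assoc, mul_left_comm]

lemma onA₂_conjTranspose_mulVec {a b c c' d : ℕ} (K : Matrix (Fin c') (Fin c) ℂ)
    (x : Fin a → ℂ) (y : Fin b → ℂ) (z : Fin c' → ℂ) (u : Fin d → ℂ) :
    (onA₂ a b d K)ᴴ *ᵥ prodVec x y z u = prodVec x y (Kᴴ *ᵥ z) u := by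
  ext p
  simp only [onA₂, prodVec, Matrix.mulVec, dotProduct, Matrix.conjTranspose_kronecker,
    Matrix.conjTranspose_one, Matrix.kroneckerMap_apply, Fintype.sum_prod_type, Matrix.one_apply,
    Finset.sum_mul, Finset.mul_sum, Prod.ext_iff]
  simp [ite_and, mul_assoc, mul_left_comm]

lemma onB₂_conjTranspose_mulVec {a b c d d' : ℕ} (K : Matrix (Fin d') (Fin d) ℂ)
    (x : Fin a → ℂ) (y : Fin b → ℂ) (z : Fin c → ℂ) (u : Fin d' → ℂ) :
    (onB₂ a b c K)ᴴ *ᵥ prodVec x y z u = prodVec x y z (Kᴴ *ᵥ u) := by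
  ext p
  simp only [onB₂, prodVec, Matrix.mulVec, dotProduct, Matrix.conjTranspose_kronecker,
    Matrix.conjTranspose_one, Matrix.kroneckerMap_apply, Fintype.sum_prod_type, Matrix.one_apply,
    Finset.mul_sum, Prod.ext_iff]
  simp [ite_and, mul_assoc, mul_left_comm]

lemma pullback_mem_separable {a b c d a' b' c' d' : ℕ} {R : Op a' b' c' d' a b c d}
    (hR : ∀ x y z u, ∃ x' y' z' u', Rᴴ *ᵥ prodVec x y z u = prodVec x' y' z' u')
    {S : Op a' b' c' d' a' b' c' d'} (hS : S ∈ separable a' b' c' d') :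
    pullback R S ∈ separable a b c d := by
  induction hS using AddSubmonoid.closure_induction with
  | mem M hM =>
    obtain ⟨x, y, z, u, rfl⟩ := hM
    obtain ⟨x', y', z', u', h⟩ := hR x y z u
    rw [pullback_ketbra, h]
    exact ketbra_prodVec_mem _ _ _ _
  | zero => rw [pullback_zero]; exact zero_mem _
  | add M N _ _ hM hN => rw [pullback_add]; exact add_mem hM hN

lemma one_mem_separable (a b c d : ℕ) : (1 : Op a b c d a b c d) ∈ separable a b c d := by
  have h : (1 : Op a b c d a b c d) = ∑ p : (Fin a × Fin b) × (Fin c × Fin d),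
      ketbra (prodVec (Pi.single p.1.1 1) (Pi.single p.1.2 1) (Pi.single p.2.1 1)
        (Pi.single p.2.2 1)) := by
    ext p q
    simp only [Matrix.sum_apply, ketbra, Matrix.vecMulVec_apply, prodVec, Pi.star_apply,
      Fintype.sum_prod_type, Matrix.one_apply, Prod.ext_iff, Pi.single_apply]
    simp [ite_and]
    split_ifs <;> simp_all
  rw [h]
  exact sum_mem fun p _ => ketbra_prodVec_mem _ _ _ _

theorem LOCC.mem_separable {a b c d : ℕ} {T₀ T₁ : Op a b c d a b c d} (h : LOCC a b c d T₀ T₁) :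
    T₀ ∈ separable a b c d ∧ T₁ ∈ separable a b c d := by
  induction h with
  | accept a b c d => exact ⟨one_mem_separable a b c d, zero_mem _⟩
  | reject a b c d => exact ⟨zero_mem _, one_mem_separable a b c d⟩
  | roundA₁ K _ S₀ S₁ _ ih =>
    exact ⟨sum_mem fun i _ => pullback_mem_separable
        (fun x y z u => ⟨_, _, _, _, onA₁_conjTranspose_mulVec (K i) x y z u⟩) (ih i).1,
      sum_mem fun i _ => pullback_mem_separable
        (fun x y z u => ⟨_, _, _, _, onA₁_conjTranspose_mulVec (K i) x y z u⟩) (ih i).2⟩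
  | roundB₁ K _ S₀ S₁ _ ih =>
    exact ⟨sum_mem fun i _ => pullback_mem_separable
        (fun x y z u => ⟨_, _, _, _, onB₁_conjTranspose_mulVec (K i) x y z u⟩) (ih i).1,
      sum_mem fun i _ => pullback_mem_separable
        (fun x y z u => ⟨_, _, _, _, onB₁_conjTranspose_mulVec (K i) x y z u⟩) (ih i).2⟩
  | roundA₂ K _ S₀ S₁ _ ih =>
    exact ⟨sum_mem fun i _ => pullback_mem_separable
        (fun x y z u => ⟨_, _, _, _, onA₂_conjTranspose_mulVec (K i) x y z u⟩) (ih i).1,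
      sum_mem fun i _ => pullback_mem_separable
        (fun x y z u => ⟨_, _, _, _, onA₂_conjTranspose_mulVec (K i) x y z u⟩) (ih i).2⟩
  | roundB₂ K _ S₀ S₁ _ ih =>
    exact ⟨sum_mem fun i _ => pullback_mem_separable
        (fun x y z u => ⟨_, _, _, _, onB₂_conjTranspose_mulVec (K i) x y z u⟩) (ih i).1,
      sum_mem fun i _ => pullback_mem_separable
        (fun x y z u => ⟨_, _, _, _, onB₂_conjTranspose_mulVec (K i) x y z u⟩) (ih i).2⟩

lemma posSemidef_ketbra {ι : Type*} [Finite ι] (v : ι → ℂ) : (ketbra v).PosSemidef :=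
  Matrix.posSemidef_vecMulVec_self_star v

lemma posSemidef_of_mem_separable {a b c d : ℕ} {T : Op a b c d a b c d}
    (hT : T ∈ separable a b c d) : T.PosSemidef := by
  induction hT using AddSubmonoid.closure_induction with
  | mem M hM => obtain ⟨x, y, z, u, rfl⟩ := hM; exact posSemidef_ketbra _
  | zero => exact Matrix.PosSemidef.zero
  | add M N _ _ hM hN => exact hM.add hN

/-! ### Building protocols -/

lemma pullback_one_of_sum {m n ι : Type*} [Fintype m] [Fintype ι] [DecidableEq m]
    [DecidableEq n] (R : ι → Matrix m n ℂ) (hR : ∑ i, (R i)ᴴ * R i = 1)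
    (S₀ S₁ : ι → Matrix m m ℂ) (h : ∀ i, S₀ i + S₁ i = 1) :
    ∑ i, pullback (R i) (S₀ i) + ∑ i, pullback (R i) (S₁ i) = 1 := by
  rw [← Finset.sum_add_distrib]
  simp only [← pullback_add, h]
  simpa [pullback] using hR

lemma sum_onA₁ {a a' n : ℕ} (b c d : ℕ) (K : Fin n → Matrix (Fin a') (Fin a) ℂ)
    (hK : ∑ i, (K i)ᴴ * K i = 1) : ∑ i, (onA₁ b c d (K i))ᴴ * onA₁ b c d (K i) = 1 := by
  simp only [onA₁, Matrix.conjTranspose_kronecker, ← Matrix.mul_kronecker_mul,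
    Matrix.conjTranspose_one, mul_one]
  ext p q
  have h := fun p q => congrFun (congrFun hK p) q
  simp only [Matrix.sum_apply] at h
  simp only [Matrix.sum_apply, Matrix.kroneckerMap_apply, ← Finset.sum_mul, h]
  simp only [Matrix.one_apply, Prod.ext_iff]
  split_ifs <;> simp_all

lemma sum_onB₁ {b b' n : ℕ} (a c d : ℕ) (K : Fin n → Matrix (Fin b') (Fin b) ℂ)
    (hK : ∑ i, (K i)ᴴ * K i = 1) : ∑ i, (onB₁ a c d (K i))ᴴ * onB₁ a c d (K i) = 1 := by
  simp only [onB₁, Matrix.conjTranspose_kronecker, ← Matrix.mul_kronecker_mul,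
    Matrix.conjTranspose_one, mul_one]
  ext p q
  have h := fun p q => congrFun (congrFun hK p) q
  simp only [Matrix.sum_apply] at h
  simp only [Matrix.sum_apply, Matrix.kroneckerMap_apply, ← Finset.sum_mul, ← Finset.mul_sum, h]
  simp only [Matrix.one_apply, Prod.ext_iff]
  split_ifs <;> simp_all

lemma sum_onA₂ {c c' n : ℕ} (a b d : ℕ) (K : Fin n → Matrix (Fin c') (Fin c) ℂ)
    (hK : ∑ i, (K i)ᴴ * K i = 1) : ∑ i, (onA₂ a b d (K i))ᴴ * onA₂ a b d (K i) = 1 := by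
  simp only [onA₂, Matrix.conjTranspose_kronecker, ← Matrix.mul_kronecker_mul,
    Matrix.conjTranspose_one, mul_one]
  ext p q
  have h := fun p q => congrFun (congrFun hK p) q
  simp only [Matrix.sum_apply] at h
  simp only [Matrix.sum_apply, Matrix.kroneckerMap_apply, ← Finset.sum_mul, ← Finset.mul_sum, h]
  simp only [Matrix.one_apply, Prod.ext_iff]
  split_ifs <;> simp_all

lemma sum_onB₂ {d d' n : ℕ} (a b c : ℕ) (K : Fin n → Matrix (Fin d') (Fin d) ℂ)
    (hK : ∑ i, (K i)ᴴ * K i = 1) : ∑ i, (onB₂ a b c (K i))ᴴ * onB₂ a b c (K i) = 1 := by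
  simp only [onB₂, Matrix.conjTranspose_kronecker, ← Matrix.mul_kronecker_mul,
    Matrix.conjTranspose_one, mul_one]
  ext p q
  have h := fun p q => congrFun (congrFun hK p) q
  simp only [Matrix.sum_apply] at h
  simp only [Matrix.sum_apply, Matrix.kroneckerMap_apply, ← Finset.mul_sum, h]
  simp only [Matrix.one_apply, Prod.ext_iff]
  split_ifs <;> simp_all

theorem LOCC.add_eq_one {a b c d : ℕ} {T₀ T₁ : Op a b c d a b c d} (h : LOCC a b c d T₀ T₁) :
    T₀ + T₁ = 1 := by
  induction h with
  | accept => exact add_zero _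
  | reject => exact zero_add _
  | roundA₁ K hK S₀ S₁ _ ih => exact pullback_one_of_sum _ (sum_onA₁ _ _ _ K hK) S₀ S₁ ih
  | roundB₁ K hK S₀ S₁ _ ih => exact pullback_one_of_sum _ (sum_onB₁ _ _ _ K hK) S₀ S₁ ih
  | roundA₂ K hK S₀ S₁ _ ih => exact pullback_one_of_sum _ (sum_onA₂ _ _ _ K hK) S₀ S₁ ih
  | roundB₂ K hK S₀ S₁ _ ih => exact pullback_one_of_sum _ (sum_onB₂ _ _ _ K hK) S₀ S₁ ih

lemma LOCC.isLocal {T₀ T₁ : Matrix TwoPairs TwoPairs ℂ} (h : LOCC 2 2 2 2 T₀ T₁) :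
    IsLocal T₀ := by
  have : T₁ = 1 - T₀ := eq_sub_of_add_eq' h.add_eq_one
  rw [IsLocal, ← this]
  exact h

lemma IsLocal.isTest {T₀ : Matrix TwoPairs TwoPairs ℂ} (h : IsLocal T₀) : IsTest T₀ :=
  ⟨posSemidef_of_mem_separable h.mem_separable.1, posSemidef_of_mem_separable h.mem_separable.2⟩

/-- Local tests can be mixed by means of shared randomness: one party performs a trivial
measurement with Kraus operators `√(r i) • 1`. -/
lemma IsLocal.convex_sum {n : ℕ} (r : Fin n → ℝ) (hr : ∀ i, 0 ≤ r i) (hsum : ∑ i, r i = 1)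
    (T : Fin n → Matrix TwoPairs TwoPairs ℂ) (hT : ∀ i, IsLocal (T i)) :
    IsLocal (∑ i, (r i : ℂ) • T i) := by
  let K : Fin n → Matrix (Fin 2) (Fin 2) ℂ := fun i => ((Real.sqrt (r i) : ℝ) : ℂ) • 1
  have hK : ∑ i, (K i)ᴴ * K i = 1 := by
    have h1 : ∀ i, (K i)ᴴ * K i = (r i : ℂ) • 1 := fun i => by
      simp [K, smul_smul, Real.mul_self_sqrt (hr i)]
    simp only [h1]
    rw [← Finset.sum_smul, ← Complex.ofReal_sum, hsum]
    simp
  have h2 : ∀ i S, pullback (onA₁ 2 2 2 (K i)) S = (r i : ℂ) • S := fun i S => by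
    simp [K, pullback, onA₁, Matrix.smul_kronecker, smul_smul, Real.mul_self_sqrt (hr i)]
  have h3 := LOCC.roundA₁ K hK T (fun i => 1 - T i) hT
  simp only [h2] at h3
  exact h3.isLocal

/-! ### The Bell basis -/

/-- The matrix whose columns are the Bell vectors `φ⁰, φ¹, φ², φ³`. -/
def bellMatrix : Matrix Pair (Fin 4) ℂ := Matrix.of fun p i => bell i p

/-- The matrix whose columns are the vectors `e^{ij}`. -/
def bellMatrix₂ : Matrix TwoPairs (Fin 4 × Fin 4) ℂ := bellMatrix ⊗ₖ bellMatrix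

lemma star_inv_sqrt (x : ℝ) : star ((Real.sqrt x : ℝ) : ℂ)⁻¹ = ((Real.sqrt x : ℝ) : ℂ)⁻¹ := by
  rw [star_inv₀, Complex.star_def, Complex.conj_ofReal]

lemma inv_sqrt_two_mul_self : ((Real.sqrt 2 : ℝ) : ℂ)⁻¹ * ((Real.sqrt 2 : ℝ) : ℂ)⁻¹ = 1 / 2 := by
  rw [← mul_inv, ← Complex.ofReal_mul, Real.mul_self_sqrt (by norm_num)]
  norm_num

/-- `√2` times the Bell matrix, with entries in `{0, 1, -1, i, -i}`. -/
def bellMatrixScaled : Matrix Pair (Fin 4) ℂ := Matrix.of fun p i =>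
  (![(!![1, 0; 0, 1] : Matrix (Fin 2) (Fin 2) ℂ), !![0, Complex.I; Complex.I, 0], !![0, -1; 1, 0],
    !![Complex.I, 0; 0, -Complex.I]] : Fin 4 → Matrix (Fin 2) (Fin 2) ℂ) i p.1 p.2

lemma bellMatrix_eq : bellMatrix = ((Real.sqrt 2 : ℝ) : ℂ)⁻¹ • bellMatrixScaled := by
  ext ⟨a, b⟩ i
  fin_cases i <;> fin_cases a <;> fin_cases b <;>
    simp [bellMatrix, bellMatrixScaled, bell, ket, Pi.single_apply, div_eq_mul_inv, mul_comm]

/-- Conjugation by the Bell matrix only involves `√2 ^ 2`. -/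
lemma bellMatrix_conj (M : Matrix Pair Pair ℂ) :
    bellMatrixᴴ * M * bellMatrix = (1 / 2 : ℂ) • (bellMatrixScaledᴴ * M * bellMatrixScaled) := by
  rw [bellMatrix_eq, ← inv_sqrt_two_mul_self]
  simp [smul_smul]

lemma bellMatrix_isometry : bellMatrixᴴ * bellMatrix = 1 := by
  have h := bellMatrix_conj 1
  rw [Matrix.mul_one, Matrix.mul_one] at h
  rw [h]
  ext i j
  fin_cases i <;> fin_cases j <;>
    simp [bellMatrixScaled, Matrix.mul_apply, Fintype.sum_prod_type] <;> norm_num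

lemma bellMatrix_coisometry : bellMatrix * bellMatrixᴴ = 1 := by
  have h : bellMatrix * bellMatrixᴴ = (1 / 2 : ℂ) • (bellMatrixScaled * bellMatrixScaledᴴ) := by
    rw [bellMatrix_eq, ← inv_sqrt_two_mul_self]
    simp [smul_smul]
  rw [h]
  ext ⟨a, b⟩ ⟨c, d⟩
  fin_cases a <;> fin_cases b <;> fin_cases c <;> fin_cases d <;>
    simp [bellMatrixScaled, Matrix.mul_apply, Fin.sum_univ_four] <;> norm_num

lemma bellMatrix₂_isometry : bellMatrix₂ᴴ * bellMatrix₂ = 1 := by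
  rw [bellMatrix₂, Matrix.conjTranspose_kronecker, ← Matrix.mul_kronecker_mul,
    bellMatrix_isometry, Matrix.one_kronecker_one]

lemma bellMatrix₂_coisometry : bellMatrix₂ * bellMatrix₂ᴴ = 1 := by
  rw [bellMatrix₂, Matrix.conjTranspose_kronecker, ← Matrix.mul_kronecker_mul,
    bellMatrix_coisometry, Matrix.one_kronecker_one]

/-- The matrix of a two-sample operator in the basis `e^{ij}`. -/
def inBell (T : Matrix TwoPairs TwoPairs ℂ) : Matrix (Fin 4 × Fin 4) (Fin 4 × Fin 4) ℂ :=
  pullback bellMatrix₂ T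

lemma inBell_injective : Function.Injective inBell := by
  have h : ∀ T, bellMatrix₂ * inBell T * bellMatrix₂ᴴ = T := fun T => by
    simp only [inBell, pullback, ← Matrix.mul_assoc]
    rw [bellMatrix₂_coisometry, Matrix.one_mul, Matrix.mul_assoc, bellMatrix₂_coisometry,
      Matrix.mul_one]
  exact Function.LeftInverse.injective (g := fun S => bellMatrix₂ * S * bellMatrix₂ᴴ) h

lemma inBell_mul (S T : Matrix TwoPairs TwoPairs ℂ) : inBell (S * T) = inBell S * inBell T := by
  simp only [inBell, pullback]
  calc bellMatrix₂ᴴ * (S * T) * bellMatrix₂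
      = bellMatrix₂ᴴ * S * (1 : Matrix TwoPairs TwoPairs ℂ) * T * bellMatrix₂ := by
        simp only [Matrix.mul_one, Matrix.mul_assoc]
    _ = _ := by rw [← bellMatrix₂_coisometry]; simp only [Matrix.mul_assoc]

lemma inBell_one : inBell 1 = 1 := by simp [inBell, pullback, bellMatrix₂_isometry]

lemma inBell_conjTranspose (T : Matrix TwoPairs TwoPairs ℂ) : inBell Tᴴ = (inBell T)ᴴ := by
  simp [inBell, pullback, Matrix.mul_assoc]

lemma inBell_add (S T : Matrix TwoPairs TwoPairs ℂ) : inBell (S + T) = inBell S + inBell T :=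
  pullback_add _ _ _

lemma inBell_sub (S T : Matrix TwoPairs TwoPairs ℂ) : inBell (S - T) = inBell S - inBell T := by
  simp [inBell, pullback, Matrix.mul_sub, Matrix.sub_mul]

lemma inBell_kronecker (ρ σ : Matrix Pair Pair ℂ) :
    inBell (ρ ⊗ₖ σ) = pullback bellMatrix ρ ⊗ₖ pullback bellMatrix σ := by
  simp only [inBell, pullback, bellMatrix₂, Matrix.conjTranspose_kronecker,
    ← Matrix.mul_kronecker_mul]

lemma trace_inBell (T : Matrix TwoPairs TwoPairs ℂ) : (inBell T).trace = T.trace := by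
  rw [inBell, pullback, Matrix.trace_mul_comm, ← Matrix.mul_assoc,
    bellMatrix₂_coisometry, Matrix.one_mul]

lemma bellMatrix_conjTranspose_mulVec_bell (i : Fin 4) :
    bellMatrixᴴ *ᵥ bell i = Pi.single i 1 := by
  have h : bell i = bellMatrix *ᵥ Pi.single i 1 := by
    ext p; simp [bellMatrix]
  rw [h, Matrix.mulVec_mulVec, bellMatrix_isometry, Matrix.one_mulVec]

lemma bellMatrix₂_conjTranspose_mulVec_e (i j : Fin 4) :
    bellMatrix₂ᴴ *ᵥ e i j = Pi.single (i, j) 1 := by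
  have h : e i j = bellMatrix₂ *ᵥ Pi.single (i, j) 1 := by
    ext p; simp [bellMatrix₂, bellMatrix, e]
  rw [h, Matrix.mulVec_mulVec, bellMatrix₂_isometry, Matrix.one_mulVec]

lemma inBell_ketbra (v : TwoPairs → ℂ) : inBell (ketbra v) = ketbra (bellMatrix₂ᴴ *ᵥ v) :=
  pullback_ketbra _ _

/-- The Bell components of a vector of one sample. -/
def bellComponents (w : Pair → ℂ) : Fin 4 → ℂ := bellMatrixᴴ *ᵥ w

lemma bellMatrix₂_conjTranspose_mulVec_mul (w w' : Pair → ℂ) (i j : Fin 4) :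
    (bellMatrix₂ᴴ *ᵥ fun p : TwoPairs => w p.1 * w' p.2) (i, j) =
      bellComponents w i * bellComponents w' j := by
  simp only [bellMatrix₂, bellComponents, Matrix.mulVec, dotProduct,
    Matrix.conjTranspose_kronecker, Matrix.kroneckerMap_apply, Fintype.sum_prod_type (α₁ := Pair),
    Finset.sum_mul_sum]
  exact Finset.sum_congr rfl fun p _ => Finset.sum_congr rfl fun q _ => by ring

/-- For product vectors of one sample, a bilinear (not sesquilinear) sum of squares of the Bell
components vanishes: it is twice the determinant of the coefficient matrix. -/
lemma sum_sq_bellComponents_prod (x y : Fin 2 → ℂ) :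
    ∑ i, bellComponents (fun p => x p.1 * y p.2) i ^ 2 = 0 := by
  have h2 : (((Real.sqrt 2 : ℝ) : ℂ)⁻¹) ^ 2 = 1 / 2 := by rw [sq, inv_sqrt_two_mul_self]
  simp only [bellComponents, bellMatrix_eq]
  simp only [Fin.sum_univ_four, Matrix.mulVec, dotProduct, Fintype.sum_prod_type, Fin.sum_univ_two,
    Matrix.conjTranspose_apply, Matrix.smul_apply, bellMatrixScaled, Matrix.of_apply]
  simp
  linear_combination (((Real.sqrt 2 : ℝ) : ℂ)⁻¹) ^ 2 *
    ((x 0 * y 1 + x 1 * y 0) ^ 2 + (x 0 * y 0 - x 1 * y 1) ^ 2) * Complex.I_sq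

/-! ### Invariance in the Bell basis -/

lemma commute_inBell {W T : Matrix TwoPairs TwoPairs ℂ} (hW : W * Wᴴ = 1)
    (h : Wᴴ * T * W = T) : Commute (inBell T) (inBell W) := by
  have h1 : T * W = W * T := by
    have h2 := congrArg (W * ·) h
    simp only [← mul_assoc, hW, one_mul] at h2
    exact h2
  rw [Commute, SemiconjBy, ← inBell_mul, ← inBell_mul, h1]

/-! ### Symmetries in the Bell basis -/

/-- The map `g ↦ g ⊗ ḡ` in the Bell basis. For `g ∈ SU(2)` it fixes `φ⁰` and acts on
`φ¹, φ², φ³` as a rotation of three-dimensional space. -/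
def bellRotation (g : Matrix (Fin 2) (Fin 2) ℂ) : Matrix (Fin 4) (Fin 4) ℂ :=
  pullback bellMatrix (g ⊗ₖ g.map star)

lemma inBell_V (g : Matrix (Fin 2) (Fin 2) ℂ) :
    inBell (V g) = bellRotation g ⊗ₖ bellRotation g := inBell_kronecker _ _

lemma map_star_mul_conjTranspose {g : Matrix (Fin 2) (Fin 2) ℂ} (hg : g * gᴴ = 1) :
    g.map star * (g.map star)ᴴ = 1 := by
  ext i j
  have h := congrArg (starRingEnd ℂ) (congrFun (congrFun hg i) j)
  simpa [Matrix.mul_apply, Matrix.one_apply, apply_ite] using h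

lemma V_mul_conjTranspose {g : Matrix (Fin 2) (Fin 2) ℂ} (hg : g * gᴴ = 1) :
    V g * (V g)ᴴ = 1 := by
  simp only [V, Matrix.conjTranspose_kronecker, ← Matrix.mul_kronecker_mul, hg,
    map_star_mul_conjTranspose hg, Matrix.one_kronecker_one]

lemma mul_conjTranspose_of_mem_specialUnitaryGroup {g : Matrix (Fin 2) (Fin 2) ℂ}
    (hg : g ∈ Matrix.specialUnitaryGroup (Fin 2) ℂ) : g * gᴴ = 1 :=
  Matrix.mem_unitaryGroup_iff.1 (Matrix.mem_specialUnitaryGroup_iff.1 hg).1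

lemma IsVInvariant.commute {T : Matrix TwoPairs TwoPairs ℂ} (h : IsVInvariant T)
    {g : Matrix (Fin 2) (Fin 2) ℂ} (hg : g * gᴴ = 1) (hdet : g.det = 1) :
    Commute (inBell T) (bellRotation g ⊗ₖ bellRotation g) := by
  rw [← inBell_V]
  refine commute_inBell (V_mul_conjTranspose hg) (h g ?_)
  exact Matrix.mem_specialUnitaryGroup_iff.2 ⟨Matrix.mem_unitaryGroup_iff.2 hg, hdet⟩

/-- The AB-transposition of one sample. -/
def abTransposition₁ : Matrix Pair Pair ℂ := Matrix.of fun p q =>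
  if p = (1 - q.2, 1 - q.1) then (-1) ^ (q.1.val + q.2.val) else 0

lemma abTransposition_eq : abTransposition = abTransposition₁ ⊗ₖ abTransposition₁ := by
  ext p q
  simp only [abTransposition, abTransposition₁, Matrix.kroneckerMap_apply, Matrix.of_apply,
    Prod.ext_iff]
  split_ifs <;> simp_all [pow_add, mul_assoc]

lemma pullback_abTransposition₁ :
    pullback bellMatrix abTransposition₁ = Matrix.diagonal ![1, -1, -1, -1] := by
  rw [pullback, bellMatrix_conj]
  ext i j
  fin_cases i <;> fin_cases j <;>
    simp [bellMatrixScaled, abTransposition₁, Matrix.mul_apply, Fintype.sum_prod_type] <;>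
    norm_num

lemma inBell_abTransposition :
    inBell abTransposition =
      Matrix.diagonal ![1, -1, -1, -1] ⊗ₖ Matrix.diagonal ![1, -1, -1, -1] := by
  rw [abTransposition_eq, inBell_kronecker, pullback_abTransposition₁]

lemma abTransposition_mul_conjTranspose : abTransposition * abTranspositionᴴ = 1 := by
  apply inBell_injective
  rw [inBell_mul, inBell_conjTranspose, inBell_abTransposition, inBell_one,
    Matrix.conjTranspose_kronecker, ← Matrix.mul_kronecker_mul, Matrix.diagonal_conjTranspose,
    Matrix.diagonal_mul_diagonal]
  have : (Matrix.diagonal fun i : Fin 4 => (![1, -1, -1, -1] : Fin 4 → ℂ) i *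
      star (![1, -1, -1, -1] : Fin 4 → ℂ) i) = 1 := by
    rw [← Matrix.diagonal_one]
    congr 1
    ext i
    fin_cases i <;> simp
  rw [this, Matrix.one_kronecker_one]

lemma IsABInvariant.commute {T : Matrix TwoPairs TwoPairs ℂ} (h : IsABInvariant T) :
    Commute (inBell T)
      (Matrix.diagonal ![1, -1, -1, -1] ⊗ₖ Matrix.diagonal ![1, -1, -1, -1]) := by
  rw [← inBell_abTransposition]
  exact commute_inBell abTransposition_mul_conjTranspose h

lemma bellRotation_halfTurn_one :
    bellRotation !![0, Complex.I; Complex.I, 0] = Matrix.diagonal ![1, 1, -1, -1] := by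
  rw [bellRotation, pullback, bellMatrix_conj]
  ext i j
  fin_cases i <;> fin_cases j <;>
    simp [bellMatrixScaled, Matrix.mul_apply, Fintype.sum_prod_type] <;> norm_num

lemma bellRotation_halfTurn_two :
    bellRotation !![0, 1; -1, 0] = Matrix.diagonal ![1, -1, 1, -1] := by
  rw [bellRotation, pullback, bellMatrix_conj]
  ext i j
  fin_cases i <;> fin_cases j <;>
    simp [bellMatrixScaled, Matrix.mul_apply, Fintype.sum_prod_type] <;> norm_num

lemma bellRotation_halfTurn_three :
    bellRotation !![Complex.I, 0; 0, -Complex.I] = Matrix.diagonal ![1, -1, -1, 1] := by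
  rw [bellRotation, pullback, bellMatrix_conj]
  ext i j
  fin_cases i <;> fin_cases j <;>
    simp [bellMatrixScaled, Matrix.mul_apply, Fintype.sum_prod_type] <;> norm_num

/-- The cyclic permutation `1 ↦ 2 ↦ 3 ↦ 1` of the Bell indices, fixing `0`. -/
def cyc : Fin 4 → Fin 4 := ![0, 2, 3, 1]

lemma cyc_succ : ∀ i : Fin 3, cyc i.succ = (i + 1).succ := by decide

lemma cyc_injective : Function.Injective cyc := by decide

/-- The permutation matrix of `cyc`, a rotation by a third of a turn. -/
def cycMatrix : Matrix (Fin 4) (Fin 4) ℂ := Matrix.of fun i j => if i = cyc j then 1 else 0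

/-- An element of `SU(2)` that permutes `φ¹, φ², φ³` cyclically. -/
def cycElement : Matrix (Fin 2) (Fin 2) ℂ :=
  !![⟨1 / 2, 1 / 2⟩, ⟨-1 / 2, 1 / 2⟩; ⟨1 / 2, 1 / 2⟩, ⟨1 / 2, -1 / 2⟩]

lemma bellRotation_cycElement : bellRotation cycElement = cycMatrix := by
  rw [bellRotation, pullback, bellMatrix_conj]
  ext i j
  fin_cases i <;> fin_cases j <;>
    simp [bellMatrixScaled, cycElement, cycMatrix, cyc, Matrix.mul_apply, Fintype.sum_prod_type,
      Complex.ext_iff, Fin.ext_iff] <;> norm_num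

/-- A rotation about the third axis by an angle with rational sine and cosine, neither of them
zero. -/
def tiltMatrix : Matrix (Fin 4) (Fin 4) ℂ :=
  !![1, 0, 0, 0; 0, -7 / 25, -24 / 25, 0; 0, 24 / 25, -7 / 25, 0; 0, 0, 0, 1]

/-- The element of `SU(2)` whose rotation is `tiltMatrix`. -/
def tiltElement : Matrix (Fin 2) (Fin 2) ℂ :=
  !![⟨3 / 5, 4 / 5⟩, 0; 0, ⟨3 / 5, -4 / 5⟩]

lemma bellRotation_tiltElement : bellRotation tiltElement = tiltMatrix := by
  rw [bellRotation, pullback, bellMatrix_conj]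
  ext i j
  fin_cases i <;> fin_cases j <;>
    simp [bellMatrixScaled, tiltElement, tiltMatrix, Matrix.mul_apply, Fintype.sum_prod_type,
      Complex.ext_iff] <;> norm_num

/-- The sign of the reflection that flips the Bell vector `φ^{m+1}`. -/
def flipSign (m : Fin 3) (i : Fin 4) : ℤ := if i = m.succ then -1 else 1

lemma diagonal_kronecker_entry {τ : Matrix (Fin 4 × Fin 4) (Fin 4 × Fin 4) ℂ} {d : Fin 4 → ℂ}
    (h : Commute τ (Matrix.diagonal d ⊗ₖ Matrix.diagonal d)) (p q : Fin 4 × Fin 4) :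
    τ p q * (d q.1 * d q.2) = d p.1 * d p.2 * τ p q := by
  have h1 := congrFun (congrFun h p) q
  rwa [Matrix.diagonal_kronecker_diagonal, Matrix.mul_diagonal, Matrix.diagonal_mul] at h1

/-- Operators, written in the Bell basis, that commute with the symmetries of `ℝ³` acting on both
samples. The reflections, one cyclic permutation and one tilted rotation generate enough of the
orthogonal group. -/
structure IsIsotropic (τ : Matrix (Fin 4 × Fin 4) (Fin 4 × Fin 4) ℂ) : Prop where
  flip : ∀ (m : Fin 3) (p q : Fin 4 × Fin 4), τ p q * (flipSign m q.1 * flipSign m q.2) =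
    flipSign m p.1 * flipSign m p.2 * τ p q
  cycle : Commute τ (cycMatrix ⊗ₖ cycMatrix)
  tilt : Commute τ (tiltMatrix ⊗ₖ tiltMatrix)

theorem isIsotropic_inBell {T : Matrix TwoPairs TwoPairs ℂ} (hV : IsVInvariant T)
    (hF : IsABInvariant T) : IsIsotropic (inBell T) where
  flip := by
    -- Composing the AB-transposition with a half turn flips a single axis.
    have key : ∀ (d : Fin 4 → ℂ) (m : Fin 3),
        Commute (inBell T) (Matrix.diagonal d ⊗ₖ Matrix.diagonal d) →
        (∀ i, (flipSign m i : ℂ) = (![1, -1, -1, -1] : Fin 4 → ℂ) i * d i) →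
        ∀ p q : Fin 4 × Fin 4, inBell T p q * (flipSign m q.1 * flipSign m q.2) =
          flipSign m p.1 * flipSign m p.2 * inBell T p q := by
      intro d m hd hm p q
      have h1 := diagonal_kronecker_entry hF.commute p q
      have h2 := diagonal_kronecker_entry hd p q
      simp only [hm]
      linear_combination (d q.1 * d q.2) * h1 +
        ((![1, -1, -1, -1] : Fin 4 → ℂ) p.1 * (![1, -1, -1, -1] : Fin 4 → ℂ) p.2) * h2
    intro m
    fin_cases m
    · refine key ![1, 1, -1, -1] 0 ?_ ?_
      · rw [← bellRotation_halfTurn_one]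
        refine hV.commute ?_ ?_
        · ext i j; fin_cases i <;> fin_cases j <;> simp [Matrix.mul_apply]
        · simp [Matrix.det_fin_two]
      · intro i; fin_cases i <;> simp [flipSign, Fin.ext_iff]
    · refine key ![1, -1, 1, -1] 1 ?_ ?_
      · rw [← bellRotation_halfTurn_two]
        refine hV.commute ?_ ?_
        · ext i j; fin_cases i <;> fin_cases j <;> simp [Matrix.mul_apply]
        · simp [Matrix.det_fin_two]
      · intro i; fin_cases i <;> simp [flipSign, Fin.ext_iff]
    · refine key ![1, -1, -1, 1] 2 ?_ ?_
      · rw [← bellRotation_halfTurn_three]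
        refine hV.commute ?_ ?_
        · ext i j; fin_cases i <;> fin_cases j <;> simp [Matrix.mul_apply]
        · simp [Matrix.det_fin_two]
      · intro i; fin_cases i <;> simp [flipSign, Fin.ext_iff]
  cycle := by
    rw [← bellRotation_cycElement]
    refine hV.commute ?_ ?_
    · ext i j
      fin_cases i <;> fin_cases j <;>
        simp [cycElement, Matrix.mul_apply, Complex.ext_iff] <;> norm_num
    · simp [cycElement, Matrix.det_fin_two, Complex.ext_iff]
      norm_num
  tilt := by
    rw [← bellRotation_tiltElement]
    refine hV.commute ?_ ?_
    · ext i j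
      fin_cases i <;> fin_cases j <;>
        simp [tiltElement, Matrix.mul_apply, Complex.ext_iff] <;> norm_num
    · simp [tiltElement, Matrix.det_fin_two, Complex.ext_iff]
      norm_num

/-! ### Isotropic tensors -/

namespace IsIsotropic

variable {τ : Matrix (Fin 4 × Fin 4) (Fin 4 × Fin 4) ℂ}

/-- An entry vanishes unless each of the indices `1, 2, 3` occurs an even number of times. -/
lemma eq_zero (h : IsIsotropic τ) (m : Fin 3) {p q : Fin 4 × Fin 4}
    (hpq : flipSign m p.1 * flipSign m p.2 ≠ flipSign m q.1 * flipSign m q.2) : τ p q = 0 := by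
  have h1 := h.flip m p q
  have h2 : ((flipSign m p.1 * flipSign m p.2 - flipSign m q.1 * flipSign m q.2 : ℤ) : ℂ) ≠ 0 :=
    Int.cast_ne_zero.2 (sub_ne_zero.2 hpq)
  refine (mul_eq_zero.1 ?_).resolve_left h2
  push_cast
  linear_combination -h1

lemma apply_cyc (h : IsIsotropic τ) (i j k l : Fin 4) :
    τ (cyc i, cyc j) (cyc k, cyc l) = τ (i, j) (k, l) := by
  have h1 := congrFun (congrFun h.cycle (cyc i, cyc j)) (k, l)
  simp only [Matrix.mul_apply, Fintype.sum_prod_type, Matrix.kroneckerMap_apply, cycMatrix,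
    Matrix.of_apply, cyc_injective.eq_iff] at h1
  simpa using h1

lemma apply_succ_add_one (h : IsIsotropic τ) (i j k l : Fin 3) :
    τ ((i + 1).succ, (j + 1).succ) ((k + 1).succ, (l + 1).succ) =
      τ (i.succ, j.succ) (k.succ, l.succ) := by
  simpa only [cyc_succ] using h.apply_cyc i.succ j.succ k.succ l.succ

/-- Relations between the entries in the plane of the tilted rotation: the products of its sine and
cosine do not vanish, so they can be cancelled. -/
lemma tilt_relations (h : IsIsotropic τ) :
    (τ (1, 1) (1, 1) = τ (1, 1) (2, 2) + τ (1, 2) (1, 2) + τ (2, 1) (1, 2)) ∧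
    (τ (1, 1) (1, 1) = τ (1, 1) (2, 2) + τ (1, 2) (2, 1) + τ (2, 1) (2, 1)) ∧
    (τ (1, 1) (1, 1) = τ (2, 2) (1, 1) + τ (1, 2) (1, 2) + τ (1, 2) (2, 1)) ∧
    (τ (1, 1) (1, 1) = τ (2, 2) (1, 1) + τ (2, 1) (1, 2) + τ (2, 1) (2, 1)) := by
  have h1 := congrFun (congrFun h.tilt (1, 1)) (1, 2)
  have h2 := congrFun (congrFun h.tilt (1, 1)) (2, 1)
  have h3 := congrFun (congrFun h.tilt (1, 2)) (1, 1)
  have h4 := congrFun (congrFun h.tilt (2, 1)) (1, 1)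
  have z1 : τ (1, 1) (1, 2) = 0 := h.eq_zero 0 (by decide)
  have z2 : τ (1, 1) (2, 1) = 0 := h.eq_zero 0 (by decide)
  have z3 : τ (1, 2) (1, 1) = 0 := h.eq_zero 0 (by decide)
  have z4 : τ (2, 1) (1, 1) = 0 := h.eq_zero 0 (by decide)
  have z5 : τ (2, 2) (1, 2) = 0 := h.eq_zero 0 (by decide)
  have z6 : τ (2, 2) (2, 1) = 0 := h.eq_zero 0 (by decide)
  have z7 : τ (1, 2) (2, 2) = 0 := h.eq_zero 0 (by decide)
  have z8 : τ (2, 1) (2, 2) = 0 := h.eq_zero 0 (by decide)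
  simp [Matrix.mul_apply, Fintype.sum_prod_type, Matrix.kroneckerMap_apply, tiltMatrix,
    Fin.sum_univ_four, z1, z2, z3, z4, z5, z6, z7, z8] at h1 h2 h3 h4
  refine ⟨?_, ?_, ?_, ?_⟩
  · linear_combination (625 / 168) * h1
  · linear_combination (625 / 168) * h2
  · linear_combination (625 / 168) * h3
  · linear_combination (625 / 168) * h4

/-- On `span {e^{ij} : 1 ≤ i, j ≤ 3}` an isotropic operator is the general isotropic tensor of
rank four. -/
theorem apply_succ (h : IsIsotropic τ) (i j k l : Fin 3) :
    τ (i.succ, j.succ) (k.succ, l.succ) =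
      τ (1, 1) (2, 2) * (if i = j ∧ k = l then 1 else 0) +
      τ (1, 2) (1, 2) * (if i = k ∧ j = l then 1 else 0) +
      τ (1, 2) (2, 1) * (if i = l ∧ j = k then 1 else 0) := by
  -- The reflections and the cyclic symmetry reduce the claim to seven entries with `i = 0`.
  obtain ⟨r1, r2, r3, r4⟩ := h.tilt_relations
  have c := h.apply_cyc
  have key : ∀ j k l : Fin 3, τ ((0 : Fin 3).succ, j.succ) (k.succ, l.succ) =
      τ (1, 1) (2, 2) * (if 0 = j ∧ k = l then 1 else 0) +
      τ (1, 2) (1, 2) * (if 0 = k ∧ j = l then 1 else 0) +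
      τ (1, 2) (2, 1) * (if 0 = l ∧ j = k then 1 else 0) := by
    intro j k l
    by_cases hz : ∀ m, flipSign m (0 : Fin 3).succ * flipSign m j.succ =
        flipSign m k.succ * flipSign m l.succ
    · have cases7 : ∀ j k l : Fin 3, (∀ m, flipSign m (0 : Fin 3).succ * flipSign m j.succ =
          flipSign m k.succ * flipSign m l.succ) → (j, k, l) ∈ ({(0, 0, 0), (0, 1, 1), (0, 2, 2),
            (1, 0, 1), (2, 0, 2), (1, 1, 0), (2, 2, 0)} : Finset (Fin 3 × Fin 3 × Fin 3)) := by
        decide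
      have hmem := cases7 j k l hz
      simp only [Finset.mem_insert, Finset.mem_singleton, Prod.mk.injEq] at hmem
      have c1 : τ (1, 1) (3, 3) = τ (2, 2) (1, 1) := (c 1 1 3 3).symm
      have c2 : τ (1, 3) (1, 3) = τ (2, 1) (2, 1) := (c 1 3 1 3).symm
      have c3 : τ (1, 3) (3, 1) = τ (2, 1) (1, 2) := (c 1 3 3 1).symm
      rcases hmem with ⟨rfl, rfl, rfl⟩ | ⟨rfl, rfl, rfl⟩ | ⟨rfl, rfl, rfl⟩ | ⟨rfl, rfl, rfl⟩ |
        ⟨rfl, rfl, rfl⟩ | ⟨rfl, rfl, rfl⟩ | ⟨rfl, rfl, rfl⟩ <;> simp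
      · linear_combination (r1 + r2 + r3 - r4) / 2
      · change τ (1, 1) (3, 3) = _
        linear_combination c1 + (r1 + r2 - r3 - r4) / 2
      · change τ (1, 3) (1, 3) = _
        linear_combination c2 + (r1 + r3 - r2 - r4) / 2
      · change τ (1, 3) (3, 1) = _
        linear_combination c3 + (r2 + r3 - r1 - r4) / 2
    · push Not at hz
      obtain ⟨m, hm⟩ := hz
      have hne : ∀ m j k l : Fin 3, flipSign m (0 : Fin 3).succ * flipSign m j.succ ≠
          flipSign m k.succ * flipSign m l.succ →
          ¬(0 = j ∧ k = l) ∧ ¬(0 = k ∧ j = l) ∧ ¬(0 = l ∧ j = k) := by decide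
      obtain ⟨n1, n2, n3⟩ := hne m j k l hm
      rw [if_neg n1, if_neg n2, if_neg n3, h.eq_zero m hm]
      ring
  have shift : ∀ j : Fin 3, ∃ j', j = j' + 1 := fun j => ⟨j - 1, by simp⟩
  have step : ∀ i : Fin 3, (∀ j k l : Fin 3, τ (i.succ, j.succ) (k.succ, l.succ) =
      τ (1, 1) (2, 2) * (if i = j ∧ k = l then 1 else 0) +
      τ (1, 2) (1, 2) * (if i = k ∧ j = l then 1 else 0) +
      τ (1, 2) (2, 1) * (if i = l ∧ j = k then 1 else 0)) →
      ∀ j k l : Fin 3, τ ((i + 1).succ, j.succ) (k.succ, l.succ) =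
      τ (1, 1) (2, 2) * (if i + 1 = j ∧ k = l then 1 else 0) +
      τ (1, 2) (1, 2) * (if i + 1 = k ∧ j = l then 1 else 0) +
      τ (1, 2) (2, 1) * (if i + 1 = l ∧ j = k then 1 else 0) := by
    intro i hi j k l
    obtain ⟨j, rfl⟩ := shift j
    obtain ⟨k, rfl⟩ := shift k
    obtain ⟨l, rfl⟩ := shift l
    rw [h.apply_succ_add_one, hi]
    simp only [add_left_inj]
  fin_cases i
  · exact key j k l
  · exact step 0 key j k l
  · exact step 1 (step 0 key) j k l

lemma apply_zero_left (h : IsIsotropic τ) (i j : Fin 3) :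
    τ (0, i.succ) (0, j.succ) = τ (0, 1) (0, 1) * if i = j then 1 else 0 := by
  have c1 : τ (0, 3) (0, 3) = τ (0, 2) (0, 2) := h.apply_cyc 0 2 0 2
  have c2 : τ (0, 2) (0, 2) = τ (0, 1) (0, 1) := h.apply_cyc 0 1 0 1
  by_cases hij : i = j
  · subst hij
    rw [if_pos rfl, mul_one]
    fin_cases i
    · rfl
    · exact c2
    · exact c1.trans c2
  · rw [if_neg hij, mul_zero]
    have : ∀ i j : Fin 3, i ≠ j → flipSign i 0 * flipSign i i.succ ≠
      flipSign i 0 * flipSign i j.succ := by decide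
    exact h.eq_zero i (this i j hij)

lemma apply_zero_right (h : IsIsotropic τ) (i j : Fin 3) :
    τ (i.succ, 0) (j.succ, 0) = τ (1, 0) (1, 0) * if i = j then 1 else 0 := by
  have c1 : τ (3, 0) (3, 0) = τ (2, 0) (2, 0) := h.apply_cyc 2 0 2 0
  have c2 : τ (2, 0) (2, 0) = τ (1, 0) (1, 0) := h.apply_cyc 1 0 1 0
  by_cases hij : i = j
  · subst hij
    rw [if_pos rfl, mul_one]
    fin_cases i
    · rfl
    · exact c2
    · exact c1.trans c2
  · rw [if_neg hij, mul_zero]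
    have : ∀ i j : Fin 3, i ≠ j → flipSign i i.succ * flipSign i 0 ≠
      flipSign i j.succ * flipSign i 0 := by decide
    exact h.eq_zero i (this i j hij)

lemma eq_zero_of_exists (h : IsIsotropic τ) {p q : Fin 4 × Fin 4}
    (hpq : ∃ m, flipSign m p.1 * flipSign m p.2 ≠ flipSign m q.1 * flipSign m q.2) :
    τ p q = 0 := h.eq_zero hpq.choose hpq.choose_spec

/-- The expectation of an isotropic operator in `s ⊗ s`, when `e^{00}` is an eigenvector of
eigenvalue one and the coherences between `e^{0i}` and `e^{j0}` vanish. -/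
theorem trace_mul (h : IsIsotropic τ) (h00 : τ (0, 0) (0, 0) = 1)
    (hr : ∀ i j : Fin 3, τ (0, 0) (i.succ, j.succ) = 0)
    (hc : ∀ i j : Fin 3, τ (i.succ, j.succ) (0, 0) = 0)
    (hx : ∀ i j : Fin 3, τ (0, i.succ) (j.succ, 0) = 0)
    (hy : ∀ i j : Fin 3, τ (i.succ, 0) (0, j.succ) = 0) (s : Matrix (Fin 4) (Fin 4) ℂ) :
    ((s ⊗ₖ s) * τ).trace = s 0 0 ^ 2 +
      (τ (0, 1) (0, 1) + τ (1, 0) (1, 0)) * (s 0 0 * ∑ i : Fin 3, s i.succ i.succ) +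
      τ (1, 1) (2, 2) * (∑ i : Fin 3, ∑ j : Fin 3, s i.succ j.succ ^ 2) +
      τ (1, 2) (1, 2) * (∑ i : Fin 3, s i.succ i.succ) ^ 2 +
      τ (1, 2) (2, 1) * (∑ i : Fin 3, ∑ j : Fin 3, s i.succ j.succ * s j.succ i.succ) := by
  have e1 : ∀ i : Fin 3, τ (0, 0) (0, i.succ) = 0 := fun i =>
    h.eq_zero_of_exists (by revert i; decide)
  have e2 : ∀ i : Fin 3, τ (0, 0) (i.succ, 0) = 0 := fun i =>
    h.eq_zero_of_exists (by revert i; decide)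
  have e3 : ∀ i : Fin 3, τ (0, i.succ) (0, 0) = 0 := fun i =>
    h.eq_zero_of_exists (by revert i; decide)
  have e4 : ∀ i : Fin 3, τ (i.succ, 0) (0, 0) = 0 := fun i =>
    h.eq_zero_of_exists (by revert i; decide)
  have e5 : ∀ i j k : Fin 3, τ (0, i.succ) (j.succ, k.succ) = 0 := fun i j k =>
    h.eq_zero_of_exists (by revert i j k; decide)
  have e6 : ∀ i j k : Fin 3, τ (i.succ, 0) (j.succ, k.succ) = 0 := fun i j k =>
    h.eq_zero_of_exists (by revert i j k; decide)
  have e7 : ∀ i j k : Fin 3, τ (i.succ, j.succ) (0, k.succ) = 0 := fun i j k =>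
    h.eq_zero_of_exists (by revert i j k; decide)
  have e8 : ∀ i j k : Fin 3, τ (i.succ, j.succ) (k.succ, 0) = 0 := fun i j k =>
    h.eq_zero_of_exists (by revert i j k; decide)
  have split : ∀ f : Fin 4 → ℂ, ∑ i, f i = f 0 + ∑ i : Fin 3, f i.succ := Fin.sum_univ_succ
  simp only [Matrix.trace, Matrix.diag_apply, Matrix.mul_apply, Fintype.sum_prod_type,
    Matrix.kroneckerMap_apply, split, h00, hr, hc, hx, hy, e1, e2, e3, e4, e5, e6, e7, e8,
    h.apply_zero_left, h.apply_zero_right, h.apply_succ]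
  simp only [Fin.sum_univ_three]
  simp
  ring

end IsIsotropic

/-! ### Inequalities for separable effects -/

lemma norm_sum_mul_sq_le (a b : Fin 3 → ℂ) :
    ‖∑ i, a i * b i‖ ^ 2 ≤ (∑ i, ‖a i‖ ^ 2) * ∑ i, ‖b i‖ ^ 2 := by
  refine le_trans ?_ (Finset.sum_mul_sq_le_sq_mul_sq _ _ _)
  gcongr
  exact (norm_sum_le _ _).trans_eq (Finset.sum_congr rfl fun i _ => norm_mul _ _)

/-- The difference of the sesquilinear and the bilinear overlap of `a` and `b` is, up to sign, the
pairing of `a × ā` with `b × b̄`, so it is bounded by the Cauchy-Schwarz inequality. -/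
lemma sq_norm_sub_sq_norm_sq_le (a b : Fin 3 → ℂ) :
    (‖∑ i, a i * star (b i)‖ ^ 2 - ‖∑ i, a i * b i‖ ^ 2) ^ 2 ≤
      ((∑ i, ‖a i‖ ^ 2) ^ 2 - ‖∑ i, a i ^ 2‖ ^ 2) *
        ((∑ i, ‖b i‖ ^ 2) ^ 2 - ‖∑ i, b i ^ 2‖ ^ 2) := by
  -- The cross product of the real and the imaginary part.
  let c : (Fin 3 → ℂ) → Fin 3 → ℝ := fun a i =>
    (a (i + 1)).re * (a (i + 2)).im - (a (i + 2)).re * (a (i + 1)).im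
  have h1 : ∀ a : Fin 3 → ℂ, (∑ i, ‖a i‖ ^ 2) ^ 2 - ‖∑ i, a i ^ 2‖ ^ 2 =
      4 * ∑ i, c a i ^ 2 := by
    intro a
    simp only [c, Complex.sq_norm, Complex.normSq_apply, Fin.sum_univ_three]
    simp [sq]
    ring
  have h2 : ‖∑ i, a i * star (b i)‖ ^ 2 - ‖∑ i, a i * b i‖ ^ 2 = 4 * ∑ i, c a i * c b i := by
    simp [c, Complex.sq_norm, Complex.normSq_apply, Fin.sum_univ_three]
    ring
  rw [h1, h1, h2]
  nlinarith [Finset.sum_mul_sq_le_sq_mul_sq Finset.univ (c a) (c b)]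

/-- The bound satisfied by one product vector. Here `A, B` are the weights of its two factors on
`φ⁰`, `V, W` their weights on the complement, and `m, h` the bilinear and the sesquilinear overlap
of the components in the complement. -/
lemma product_vector_bound {A B V W m h : ℝ} (hA : 0 ≤ A) (hB : 0 ≤ B) (hm : 0 ≤ m) (hh : 0 ≤ h)
    (hAV : A ≤ V) (hBW : B ≤ W) (hmV : m ≤ V * W) (hhV : h ≤ V * W)
    (hmh : (h - m) ^ 2 ≤ (V ^ 2 - A ^ 2) * (W ^ 2 - B ^ 2)) :
    ∃ q, 0 ≤ q ∧ q ≤ m ∧ A * B - q - (A * (W - B) + B * (V - A)) ≤ V * W - h ∧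
      A * B / 2 + q / 6 - (A * (W - B) + B * (V - A)) / 2 ≤ (V * W + h) / 2 - m / 3 := by
  have hE : 0 ≤ A * (W - B) + B * (V - A) := by
    have := mul_nonneg hA (sub_nonneg.2 hBW)
    have := mul_nonneg hB (sub_nonneg.2 hAV)
    linarith
  have hABVW : A * B ≤ V * W := mul_le_mul hAV hBW hB (hA.trans hAV)
  rcases (mul_nonneg (hA.trans hAV) (hB.trans hBW)).eq_or_lt with h0 | h0
  · refine ⟨0, le_rfl, hm, ?_, ?_⟩ <;> linarith
  -- Scaling by `r ≤ 1` replaces the weights on the complement by those on `φ⁰`.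
  set r := A * B / (V * W) with hr
  have hr0 : 0 ≤ r := by positivity
  have hr1 : r ≤ 1 := (div_le_one h0).2 hABVW
  have hrAB : r * (V * W) = A * B := div_mul_cancel₀ _ h0.ne'
  have habs : |h - m| ≤ (V - A) * W + (W - B) * V := by
    apply abs_le_of_sq_le_sq _ (by
      have := mul_nonneg (sub_nonneg.2 hAV) (hB.trans hBW)
      have := mul_nonneg (sub_nonneg.2 hBW) (hA.trans hAV)
      linarith)
    have h1 : (V ^ 2 - A ^ 2) * (W ^ 2 - B ^ 2) ≤ (2 * V * (V - A)) * (2 * W * (W - B)) := by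
      apply mul_le_mul <;> nlinarith
    nlinarith [sq_nonneg ((V - A) * W - (W - B) * V)]
  have hrE : r * |h - m| ≤ A * (W - B) + B * (V - A) := by
    rw [hr, div_mul_eq_mul_div, div_le_iff₀ h0]
    have h1 := mul_le_mul_of_nonneg_left habs (mul_nonneg hA hB)
    have h2 : 0 ≤ (V - A) ^ 2 * (B * W) := by
      have := hB.trans hBW
      positivity
    have h3 : 0 ≤ (W - B) ^ 2 * (A * V) := by
      have := hA.trans hAV
      positivity
    nlinarith
  have hup : r * (h - m) ≤ r * |h - m| := mul_le_mul_of_nonneg_left (le_abs_self _) hr0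
  have hlow : r * -(h - m) ≤ r * |h - m| := mul_le_mul_of_nonneg_left (neg_le_abs _) hr0
  refine ⟨r * m, mul_nonneg hr0 hm, mul_le_of_le_one_left hm hr1, ?_, ?_⟩
  · have := mul_le_of_le_one_left (sub_nonneg.2 hhV) hr1
    nlinarith
  · have h4 : 0 ≤ (V * W + h) / 2 - m / 3 := by linarith
    have := mul_le_of_le_one_left h4 hr1
    nlinarith

lemma inBell_ketbra_prodVec (x y z u : Fin 2 → ℂ) (p q : Fin 4 × Fin 4) :
    inBell (ketbra (prodVec x y z u)) p q =
      bellComponents (fun p => x p.1 * y p.2) p.1 * bellComponents (fun p => z p.1 * u p.2) p.2 *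
      star (bellComponents (fun p => x p.1 * y p.2) q.1 *
        bellComponents (fun p => z p.1 * u p.2) q.2) := by
  rw [inBell_ketbra, ketbra, Matrix.vecMulVec_apply, Pi.star_apply,
    ← bellMatrix₂_conjTranspose_mulVec_mul, ← bellMatrix₂_conjTranspose_mulVec_mul]
  rfl

/-- The total weight on `φ⁰ ⊗ φⁱ` and `φⁱ ⊗ φ⁰`. -/
def mixedSum (τ : Matrix (Fin 4 × Fin 4) (Fin 4 × Fin 4) ℂ) : ℝ :=
  (∑ i : Fin 3, (τ (0, i.succ) (0, i.succ) + τ (i.succ, 0) (i.succ, 0))).re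

/-- The contraction of the two row indices with each other and of the two column indices with each
other. -/
def pairSum (τ : Matrix (Fin 4 × Fin 4) (Fin 4 × Fin 4) ℂ) : ℝ :=
  (∑ i : Fin 3, ∑ j : Fin 3, τ (i.succ, i.succ) (j.succ, j.succ)).re

/-- The trace on `span {e^{ij} : 1 ≤ i, j ≤ 3}`. -/
def traceSum (τ : Matrix (Fin 4 × Fin 4) (Fin 4 × Fin 4) ℂ) : ℝ :=
  (∑ i : Fin 3, ∑ j : Fin 3, τ (i.succ, j.succ) (i.succ, j.succ)).re

/-- The trace on `span {e^{ij} : 1 ≤ i, j ≤ 3}` against the exchange of the samples. -/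
def swapSum (τ : Matrix (Fin 4 × Fin 4) (Fin 4 × Fin 4) ℂ) : ℝ :=
  (∑ i : Fin 3, ∑ j : Fin 3, τ (i.succ, j.succ) (j.succ, i.succ)).re

/-- The inequalities satisfied by a separable effect with weight `ω` on `e^{00}`, total weight `L` on
`e^{0i}` and `e^{i0}`, and contractions `M, N, H` on `span {e^{ij} : 1 ≤ i, j ≤ 3}`, namely
`pairSum`, `traceSum` and `swapSum`. The existentially quantified `q` makes the conditions stable
under addition. -/
def SepBound (ω L M N H : ℝ) : Prop :=
  0 ≤ L - 2 * ω ∧ ∃ q, 0 ≤ q ∧ q ≤ M ∧ ω - q - (L - 2 * ω) ≤ N - H ∧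
    ω / 2 + q / 6 - (L - 2 * ω) / 2 ≤ (N + H) / 2 - M / 3

theorem sepBound_of_mem_separable {T : Matrix TwoPairs TwoPairs ℂ} (hT : T ∈ separable 2 2 2 2) :
    SepBound (inBell T (0, 0) (0, 0)).re (mixedSum (inBell T)) (pairSum (inBell T))
      (traceSum (inBell T)) (swapSum (inBell T)) := by
  induction hT using AddSubmonoid.closure_induction with
  | mem M hM =>
    obtain ⟨x, y, z, u, rfl⟩ := hM
    have hX := sum_sq_bellComponents_prod x y
    have hZ := sum_sq_bellComponents_prod z u
    have hτ := inBell_ketbra_prodVec x y z u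
    generalize bellComponents (fun p => x p.1 * y p.2) = X at *
    generalize bellComponents (fun p => z p.1 * u p.2) = Z at *
    have hnn : ∀ w : ℂ, (w * star w) = ((‖w‖ ^ 2 : ℝ) : ℂ) := fun w => by
      rw [Complex.star_def, Complex.mul_conj']; norm_cast
    have hA : ∀ X : Fin 4 → ℂ, ∑ i, X i ^ 2 = 0 → ‖X 0‖ ^ 2 = ‖∑ i : Fin 3, X i.succ ^ 2‖ := by
      intro X hX
      rw [Fin.sum_univ_succ] at hX
      rw [← norm_pow, eq_neg_of_add_eq_zero_left hX, norm_neg]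
    have hle : ∀ X : Fin 4 → ℂ, ∑ i, X i ^ 2 = 0 → ‖X 0‖ ^ 2 ≤ ∑ i : Fin 3, ‖X i.succ‖ ^ 2 := by
      intro X hX
      rw [hA X hX]
      exact (norm_sum_le _ _).trans_eq (Finset.sum_congr rfl fun i _ => norm_pow _ _)
    have e0 : (inBell (ketbra (prodVec x y z u)) (0, 0) (0, 0)).re = ‖X 0‖ ^ 2 * ‖Z 0‖ ^ 2 := by
      rw [hτ, hnn, Complex.ofReal_re, norm_mul, mul_pow]
    have e1 : mixedSum (inBell (ketbra (prodVec x y z u))) =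
        ‖X 0‖ ^ 2 * (∑ i : Fin 3, ‖Z i.succ‖ ^ 2) + (∑ i : Fin 3, ‖X i.succ‖ ^ 2) * ‖Z 0‖ ^ 2 := by
      simp only [mixedSum, hτ, hnn, norm_mul, mul_pow, Finset.mul_sum, Finset.sum_mul,
        ← Finset.sum_add_distrib]
      rw [Complex.re_sum]
      exact Finset.sum_congr rfl fun i _ => by rw [Complex.add_re]; simp only [Complex.ofReal_re]
    have e2 : pairSum (inBell (ketbra (prodVec x y z u))) =
        ‖∑ i : Fin 3, X i.succ * Z i.succ‖ ^ 2 := by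
      rw [← Complex.ofReal_re (‖∑ i : Fin 3, X i.succ * Z i.succ‖ ^ 2), ← hnn, pairSum, star_sum,
        Finset.sum_mul_sum]
      simp only [hτ]
    have e3 : traceSum (inBell (ketbra (prodVec x y z u))) =
        (∑ i : Fin 3, ‖X i.succ‖ ^ 2) * ∑ i : Fin 3, ‖Z i.succ‖ ^ 2 := by
      simp only [traceSum, hτ, hnn, norm_mul, mul_pow, Finset.sum_mul_sum, Complex.re_sum,
        Complex.ofReal_re]
    have e4 : swapSum (inBell (ketbra (prodVec x y z u))) =
        ‖∑ i : Fin 3, X i.succ * star (Z i.succ)‖ ^ 2 := by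
      rw [← Complex.ofReal_re (‖∑ i : Fin 3, X i.succ * star (Z i.succ)‖ ^ 2), ← hnn, swapSum,
        star_sum, Finset.sum_mul_sum]
      simp only [hτ]
      congr 1
      refine Finset.sum_congr rfl fun i _ => Finset.sum_congr rfl fun j _ => ?_
      simp only [star_mul', star_star]
      ring
    rw [e0, e1, e2, e3, e4]
    have hcs := norm_sum_mul_sq_le (fun i => X i.succ) (fun i => star (Z i.succ))
    simp only [norm_star] at hcs
    have hcross := sq_norm_sub_sq_norm_sq_le (fun i => X i.succ) (fun i => Z i.succ)
    rw [← hA X hX, ← hA Z hZ] at hcross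
    obtain ⟨q, q0, q1, q2, q3⟩ := product_vector_bound (by positivity) (by positivity)
      (by positivity) (by positivity) (hle X hX) (hle Z hZ)
      (norm_sum_mul_sq_le (fun i => X i.succ) (fun i => Z i.succ)) hcs hcross
    have hE1 := mul_nonneg (sq_nonneg ‖X 0‖) (sub_nonneg.2 (hle Z hZ))
    have hE2 := mul_nonneg (sq_nonneg ‖Z 0‖) (sub_nonneg.2 (hle X hX))
    refine ⟨?_, q, q0, q1, ?_, ?_⟩ <;> linarith
  | zero =>
    have h0 : inBell 0 = 0 := pullback_zero _
    rw [h0]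
    simp only [mixedSum, pairSum, traceSum, swapSum, Matrix.zero_apply]
    refine ⟨?_, 0, ?_, ?_, ?_, ?_⟩ <;> simp
  | add S T _ _ hS hT =>
    obtain ⟨hS, q, q0, q1, q2, q3⟩ := hS
    obtain ⟨hT, r, r0, r1, r2, r3⟩ := hT
    have e0 : (inBell (S + T) (0, 0) (0, 0)).re =
        (inBell S (0, 0) (0, 0)).re + (inBell T (0, 0) (0, 0)).re := by simp [inBell_add]
    have e1 : mixedSum (inBell (S + T)) = mixedSum (inBell S) + mixedSum (inBell T) := by
      rw [mixedSum, mixedSum, mixedSum, ← Complex.add_re, ← Finset.sum_add_distrib, inBell_add]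
      congr 1
      exact Finset.sum_congr rfl fun i _ => by simp only [Matrix.add_apply]; ring
    have e2 : pairSum (inBell (S + T)) = pairSum (inBell S) + pairSum (inBell T) := by
      simp [pairSum, inBell_add, Finset.sum_add_distrib]
    have e3 : traceSum (inBell (S + T)) = traceSum (inBell S) + traceSum (inBell T) := by
      simp [traceSum, inBell_add, Finset.sum_add_distrib]
    have e4 : swapSum (inBell (S + T)) = swapSum (inBell S) + swapSum (inBell T) := by
      simp [swapSum, inBell_add, Finset.sum_add_distrib]
    rw [e0, e1, e2, e3, e4]
    refine ⟨?_, q + r, ?_, ?_, ?_, ?_⟩ <;> linarith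

/-- A separable effect without weight on `φ⁰ ⊗ φ⁰` has no coherence between `e^{0i}` and `e^{j0}`:
each of its product vectors has a factor orthogonal to `φ⁰`. This is where locality between the
samples enters. -/
theorem eq_zero_of_mem_separable {T : Matrix TwoPairs TwoPairs ℂ} (hT : T ∈ separable 2 2 2 2) :
    0 ≤ inBell T (0, 0) (0, 0) ∧ (inBell T (0, 0) (0, 0) = 0 → ∀ i j,
      inBell T (0, 0) (i, j) = 0 ∧ inBell T (i, j) (0, 0) = 0 ∧
      inBell T (0, i) (j, 0) = 0 ∧ inBell T (i, 0) (0, j) = 0) := by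
  induction hT using AddSubmonoid.closure_induction with
  | mem M hM =>
    obtain ⟨x, y, z, u, rfl⟩ := hM
    simp only [inBell_ketbra_prodVec]
    refine ⟨mul_star_self_nonneg _, fun h0 i j => ?_⟩
    rcases mul_eq_zero.1 ((CStarRing.mul_star_self_eq_zero_iff _).1 h0) with h | h <;> simp [h]
  | zero =>
    have h0 : inBell 0 = 0 := pullback_zero _
    simp [h0]
  | add S T _ _ hS hT =>
    simp only [inBell_add, Matrix.add_apply]
    refine ⟨add_nonneg hS.1 hT.1, fun h0 i j => ?_⟩
    obtain ⟨h1, h2⟩ := (add_eq_zero_iff_of_nonneg hS.1 hT.1).1 h0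
    obtain ⟨a1, a2, a3, a4⟩ := hS.2 h1 i j
    obtain ⟨b1, b2, b3, b4⟩ := hT.2 h2 i j
    simp [a1, a2, a3, a4, b1, b2, b3, b4]

/-! ### Two samples of a state -/

lemma trace_mul_ketbra {ι : Type*} [Fintype ι] (M : Matrix ι ι ℂ) (v : ι → ℂ) :
    (M * ketbra v).trace = star v ⬝ᵥ (M *ᵥ v) := by
  rw [ketbra, Matrix.mul_vecMulVec, Matrix.trace_vecMulVec, dotProduct_comm]

lemma pullback_bellMatrix_apply (σ : Matrix Pair Pair ℂ) (i j : Fin 4) :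
    pullback bellMatrix σ i j = star (bell i) ⬝ᵥ (σ *ᵥ bell j) := by
  rw [pullback, Matrix.mul_assoc, Matrix.mul_apply]
  rfl

lemma star_e_dotProduct (σ : Matrix Pair Pair ℂ) (i j k l : Fin 4) :
    star (e i j) ⬝ᵥ ((σ ⊗ₖ σ) *ᵥ e k l) =
      pullback bellMatrix σ i k * pullback bellMatrix σ j l := by
  have h : inBell (σ ⊗ₖ σ) (i, j) (k, l) = star (e i j) ⬝ᵥ ((σ ⊗ₖ σ) *ᵥ e k l) := by
    rw [inBell, pullback, Matrix.mul_assoc, Matrix.mul_apply]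
    have h2 : ∀ p, bellMatrix₂ᴴ (i, j) p = star (e i j) p := fun p => rfl
    simp only [h2]
    rfl
  rw [← h, inBell_kronecker, Matrix.kroneckerMap_apply]

section

variable (σ : Matrix Pair Pair ℂ)

lemma trace_mul_ketbra_e (i j : Fin 4) : ((σ ⊗ₖ σ) * ketbra (e i j)).trace =
    pullback bellMatrix σ i i * pullback bellMatrix σ j j := by
  rw [trace_mul_ketbra, star_e_dotProduct]

lemma trace_mul_ketbra_eSym (i j : Fin 4) : ((σ ⊗ₖ σ) * ketbra (eSym i j)).trace =
    pullback bellMatrix σ i i * pullback bellMatrix σ j j +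
      pullback bellMatrix σ i j * pullback bellMatrix σ j i := by
  rw [trace_mul_ketbra, eSym, star_smul, smul_dotProduct, Matrix.mulVec_smul, dotProduct_smul,
    smul_smul, star_inv_sqrt, inv_sqrt_two_mul_self]
  simp only [star_add, add_dotProduct, dotProduct_add, Matrix.mulVec_add, star_e_dotProduct,
    smul_eq_mul]
  ring

lemma trace_mul_ketbra_eAlt (i j : Fin 4) : ((σ ⊗ₖ σ) * ketbra (eAlt i j)).trace =
    pullback bellMatrix σ i i * pullback bellMatrix σ j j -
      pullback bellMatrix σ i j * pullback bellMatrix σ j i := by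
  rw [trace_mul_ketbra, eAlt, star_smul, smul_dotProduct, Matrix.mulVec_smul, dotProduct_smul,
    smul_smul, star_inv_sqrt, inv_sqrt_two_mul_self]
  simp only [star_sub, sub_dotProduct, dotProduct_sub, Matrix.mulVec_sub, star_e_dotProduct,
    smul_eq_mul]
  ring

lemma inv_sqrt_three_mul_self :
    ((Real.sqrt 3 : ℝ) : ℂ)⁻¹ * ((Real.sqrt 3 : ℝ) : ℂ)⁻¹ = 1 / 3 := by
  rw [← mul_inv, ← Complex.ofReal_mul, Real.mul_self_sqrt (by norm_num)]
  norm_num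

lemma trace_mul_K1plus : ((σ ⊗ₖ σ) * K1plus).trace = 1 / 3 * ∑ i : Fin 3, ∑ j : Fin 3,
    pullback bellMatrix σ i.succ j.succ ^ 2 := by
  rw [K1plus, trace_mul_ketbra, star_smul, smul_dotProduct, Matrix.mulVec_smul, dotProduct_smul,
    smul_smul, star_inv_sqrt, inv_sqrt_three_mul_self]
  simp only [star_add, add_dotProduct, dotProduct_add, Matrix.mulVec_add, star_e_dotProduct,
    smul_eq_mul, Fin.sum_univ_three]
  simp
  ring

lemma trace_mul_K6plus : ((σ ⊗ₖ σ) * K6plus).trace =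
    ((∑ i : Fin 3, pullback bellMatrix σ i.succ i.succ) ^ 2 + ∑ i : Fin 3, ∑ j : Fin 3,
      pullback bellMatrix σ i.succ j.succ * pullback bellMatrix σ j.succ i.succ) / 2 := by
  simp only [K6plus, Matrix.mul_add, Matrix.trace_add, trace_mul_ketbra_e, trace_mul_ketbra_eSym,
    Fin.sum_univ_three]
  simp
  ring

lemma trace_mul_K3minus : ((σ ⊗ₖ σ) * K3minus).trace =
    ((∑ i : Fin 3, pullback bellMatrix σ i.succ i.succ) ^ 2 - ∑ i : Fin 3, ∑ j : Fin 3,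
      pullback bellMatrix σ i.succ j.succ * pullback bellMatrix σ j.succ i.succ) / 2 := by
  simp only [K3minus, Matrix.mul_add, Matrix.trace_add, trace_mul_ketbra_eAlt,
    Fin.sum_univ_three]
  simp
  ring

lemma ketbra_e (i j : Fin 4) : ketbra (e i j) = ketbra (bell i) ⊗ₖ ketbra (bell j) := by
  ext p q
  simp [ketbra, e, Matrix.vecMulVec_apply]
  ring

lemma trace_mul_TV : ((σ ⊗ₖ σ) * TV).trace =
    pullback bellMatrix σ 0 0 ^ 2 + 2 / 3 *
      (pullback bellMatrix σ 0 0 * ∑ i : Fin 3, pullback bellMatrix σ i.succ i.succ) +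
    1 / 10 * (((σ ⊗ₖ σ) * K6plus).trace - ((σ ⊗ₖ σ) * K1plus).trace) +
    1 / 6 * ((σ ⊗ₖ σ) * K3minus).trace := by
  simp only [TV, K5plus, L3plus, L3minus, ← ketbra_e, Matrix.mul_add, Matrix.mul_sub,
    Matrix.mul_smul, Matrix.trace_add, Matrix.trace_sub, Matrix.trace_smul, trace_mul_ketbra_e,
    trace_mul_ketbra_eSym, trace_mul_ketbra_eAlt, Fin.sum_univ_three, smul_eq_mul]
  simp
  ring

end

/-! ### Optimality -/

/-- The optimality estimate. The vector `(κ₁, κ₂, κ₃)` contains the coefficients of the isotropic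
tensor on `span {e^{ij} : 1 ≤ i, j ≤ 3}`, `α` is the total weight on the mixed components, and
`d, p, m, h` are the invariants of the state. -/
lemma optimality_bound {α κ₁ κ₂ κ₃ d p m h : ℝ}
    (hsep : SepBound 1 (3 * α) (9 * κ₁ + 3 * κ₂ + 3 * κ₃) (3 * κ₁ + 9 * κ₂ + 3 * κ₃)
      (3 * κ₁ + 3 * κ₂ + 9 * κ₃))
    (hp : 0 ≤ p) (hd : p ≤ 2 * d) (hm : 0 ≤ m) (hmh : m ≤ h) (hhp : h ≤ p ^ 2)
    (hK : (p ^ 2 - h) / 2 ≤ m) :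
    d ^ 2 + 2 / 3 * (d * p) + 1 / 10 * ((p ^ 2 + h) / 2 - 1 / 3 * m) + 1 / 6 * ((p ^ 2 - h) / 2) ≤
      d ^ 2 + α * (d * p) + κ₁ * m + κ₂ * p ^ 2 + κ₃ * h := by
  obtain ⟨hδ, q, q0, q1, q2, q3⟩ := hsep
  -- Each component of the test is bounded below, up to a multiple of the excess `3 * α - 2`.
  have b1 := mul_nonneg (sub_nonneg.2 q1) hm
  have b3 := mul_nonneg (sub_nonneg.2 q2) (sub_nonneg.2 hhp)
  have b5 := mul_nonneg (sub_nonneg.2 q3) (by linarith : 0 ≤ (p ^ 2 + h) / 2 - m / 3)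
  have bq := mul_nonneg q0 (by linarith : 0 ≤ 10 * (m / 3) + ((p ^ 2 + h) / 2 - m / 3) -
    5 * ((p ^ 2 - h) / 2))
  -- The excess is paid for at first order in `p`, the deficit is of second order.
  have bδ := mul_nonneg hδ (by nlinarith : 0 ≤ d * p / 3 - ((p ^ 2 + h) / 2 - m / 3) / 10 -
    (p ^ 2 - h) / 12)
  nlinarith

theorem typeTwoError_TV_le {σ : Matrix Pair Pair ℂ} (hσ : σ ∈ stateSet (1 / 3))
    {T : Matrix TwoPairs TwoPairs ℂ} (hT : IsAdmissible T) :
    typeTwoError TV (σ ⊗ₖ σ) ≤ typeTwoError T (σ ⊗ₖ σ) := by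
  obtain ⟨⟨hpos, htr⟩, hθ, hK⟩ := hσ
  have hiso := isIsotropic_inBell hT.vInvariant hT.abInvariant
  have hsep := sepBound_of_mem_separable hT.isLocal.mem_separable.1
  obtain ⟨h1nn, h1⟩ := eq_zero_of_mem_separable hT.isLocal.mem_separable.2
  have hlevel := hT.levelZero
  have hcomp : inBell (1 - T) = 1 - inBell T := by rw [inBell_sub, inBell_one]
  have hzero : inBell (1 - T) (0, 0) (0, 0) = 0 := by
    have h2 : (inBell (1 - T) (0, 0) (0, 0)).re ≤ 0 := by
      have h3 : (ketbra (bell 0) ⊗ₖ ketbra (bell 0) * (1 - T)).trace =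
          inBell (1 - T) (0, 0) (0, 0) := by
        rw [← ketbra_e, ← trace_inBell, inBell_mul, inBell_ketbra,
          bellMatrix₂_conjTranspose_mulVec_e, Matrix.trace_mul_comm, trace_mul_ketbra]
        simp
      rw [← h3]
      exact hlevel
    obtain ⟨h3, h4⟩ := Complex.nonneg_iff.1 h1nn
    exact Complex.ext (le_antisymm h2 h3) h4.symm
  have h2 := h1 hzero
  rw [hcomp] at hzero h2
  have h00 : inBell T (0, 0) (0, 0) = 1 := by
    rw [Matrix.sub_apply, Matrix.one_apply_eq, sub_eq_zero] at hzero
    exact hzero.symm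
  have trT := hiso.trace_mul h00
    (fun i j => by
      simpa [Matrix.one_apply, (Fin.succ_ne_zero _).symm] using (h2 i.succ j.succ).1)
    (fun i j => by
      simpa [Matrix.one_apply, (Fin.succ_ne_zero _).symm] using (h2 i.succ j.succ).2.1)
    (fun i j => by
      simpa [Matrix.one_apply, (Fin.succ_ne_zero _).symm] using (h2 i.succ j.succ).2.2.1)
    (fun i j => by
      simpa [Matrix.one_apply, (Fin.succ_ne_zero _).symm] using (h2 i.succ j.succ).2.2.2)
    (pullback bellMatrix σ)
  rw [← inBell_kronecker, ← inBell_mul, trace_inBell] at trT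
  have hpsd : (σ ⊗ₖ σ).PosSemidef := hpos.kronecker hpos
  have hk1 : 0 ≤ ((σ ⊗ₖ σ) * K1plus).trace := by
    rw [K1plus, trace_mul_ketbra]
    exact hpsd.dotProduct_mulVec_nonneg _
  have hk3 : 0 ≤ ((σ ⊗ₖ σ) * K3minus).trace := by
    simp only [K3minus, Matrix.mul_add, Matrix.trace_add, trace_mul_ketbra]
    exact add_nonneg (add_nonneg (hpsd.dotProduct_mulVec_nonneg _)
      (hpsd.dotProduct_mulVec_nonneg _)) (hpsd.dotProduct_mulVec_nonneg _)
  have trV := trace_mul_TV σ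
  have hspos : (pullback bellMatrix σ).PosSemidef := hpos.conjTranspose_mul_mul_same _
  have hstr : (pullback bellMatrix σ).trace = 1 := by
    rw [pullback, Matrix.trace_mul_comm, ← Matrix.mul_assoc, bellMatrix_coisometry,
      Matrix.one_mul, htr]
  rw [← pullback_bellMatrix_apply] at hθ
  rw [trace_mul_K1plus] at hk1 hK trV
  rw [trace_mul_K3minus] at hk3 hK trV
  rw [trace_mul_K6plus] at trV
  have hherm : ∀ i j, pullback bellMatrix σ j i = star (pullback bellMatrix σ i j) :=
    fun i j => (hspos.isHermitian.apply j i).symm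
  have hdiag : ∀ i, 0 ≤ pullback bellMatrix σ i i := fun i => hspos.diag_nonneg
  generalize pullback bellMatrix σ = s at *
  -- The invariants of the state are real.
  have hre : ∀ i, s i i = ((s i i).re : ℂ) := fun i =>
    Complex.ext rfl (Complex.nonneg_iff.1 (hdiag i)).2.symm
  obtain ⟨d, hd⟩ : ∃ d : ℝ, s 0 0 = d := ⟨_, hre 0⟩
  obtain ⟨p, hp⟩ : ∃ p : ℝ, ∑ i : Fin 3, s i.succ i.succ = p :=
    ⟨∑ i : Fin 3, (s i.succ i.succ).re, by
      rw [Complex.ofReal_sum]; exact Finset.sum_congr rfl fun i _ => hre _⟩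
  have hp0 : 0 ≤ p := by
    have : 0 ≤ (p : ℂ) := hp ▸ Finset.sum_nonneg fun i _ => hdiag _
    exact_mod_cast this
  have hdp : d + p = 1 := by
    rw [Matrix.trace, Fin.sum_univ_succ] at hstr
    simp only [Matrix.diag_apply, hd, hp] at hstr
    exact_mod_cast hstr
  have hh : ∑ i : Fin 3, ∑ j : Fin 3, s i.succ j.succ * s j.succ i.succ =
      ((∑ i : Fin 3, ∑ j : Fin 3, ‖s i.succ j.succ‖ ^ 2 : ℝ) : ℂ) := by
    push_cast
    refine Finset.sum_congr rfl fun i _ => Finset.sum_congr rfl fun j _ => ?_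
    rw [hherm i.succ j.succ, Complex.star_def, Complex.mul_conj']
  have hm : ∑ i : Fin 3, ∑ j : Fin 3, s i.succ j.succ ^ 2 =
      ((∑ i : Fin 3, ∑ j : Fin 3, (s i.succ j.succ ^ 2).re : ℝ) : ℂ) := by
    have hconj : star (∑ i : Fin 3, ∑ j : Fin 3, s i.succ j.succ ^ 2) =
        ∑ i : Fin 3, ∑ j : Fin 3, s i.succ j.succ ^ 2 := by
      simp only [star_sum, star_pow, ← hherm]
      exact Finset.sum_comm
    rw [← Complex.conj_eq_iff_re.1 hconj]
    simp only [Complex.re_sum]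
  have hmh : ∑ i : Fin 3, ∑ j : Fin 3, (s i.succ j.succ ^ 2).re ≤
      ∑ i : Fin 3, ∑ j : Fin 3, ‖s i.succ j.succ‖ ^ 2 :=
    Finset.sum_le_sum fun i _ => Finset.sum_le_sum fun j _ =>
      (Complex.re_le_norm _).trans_eq (norm_pow _ _)
  generalize ∑ i : Fin 3, ∑ j : Fin 3, ‖s i.succ j.succ‖ ^ 2 = h at hh hmh
  generalize ∑ i : Fin 3, ∑ j : Fin 3, (s i.succ j.succ ^ 2).re = m at hm hmh
  rw [hd, Complex.ofReal_re] at hθ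
  rw [hm] at hk1 hK trV trT
  rw [hp, hh] at hk3 hK trV trT
  rw [hd] at trV trT
  have hk1' : 0 ≤ m := by
    have : (0 : ℂ) ≤ ((1 / 3 * m : ℝ) : ℂ) := by push_cast; exact hk1
    have := Complex.zero_le_real.1 this
    linarith
  have hk3' : h ≤ p ^ 2 := by
    have : (0 : ℂ) ≤ (((p ^ 2 - h) / 2 : ℝ) : ℂ) := by push_cast; exact hk3
    have := Complex.zero_le_real.1 this
    linarith
  have hK' : (p ^ 2 - h) / 2 ≤ m := by
    have e1 : (((p : ℂ) ^ 2 - h) / 2).re = (p ^ 2 - h) / 2 := by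
      rw [← Complex.ofReal_re ((p ^ 2 - h) / 2)]; push_cast; rfl
    have e2 : (1 / 3 * (m : ℂ)).re = 1 / 3 * m := by
      rw [← Complex.ofReal_re (1 / 3 * m)]; push_cast; rfl
    rw [e1, e2] at hK
    linarith
  have hsepT : SepBound 1
      (3 * (inBell T (0, 1) (0, 1) + inBell T (1, 0) (1, 0)).re)
      (9 * (inBell T (1, 1) (2, 2)).re + 3 * (inBell T (1, 2) (1, 2)).re +
        3 * (inBell T (1, 2) (2, 1)).re)
      (3 * (inBell T (1, 1) (2, 2)).re + 9 * (inBell T (1, 2) (1, 2)).re +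
        3 * (inBell T (1, 2) (2, 1)).re)
      (3 * (inBell T (1, 1) (2, 2)).re + 3 * (inBell T (1, 2) (1, 2)).re +
        9 * (inBell T (1, 2) (2, 1)).re) := by
    convert hsep using 1
    · rw [h00, Complex.one_re]
    · simp [mixedSum, hiso.apply_zero_left, hiso.apply_zero_right]; ring
    · simp [pairSum, hiso.apply_succ, Fin.sum_univ_three]; ring
    · simp [traceSum, hiso.apply_succ, Fin.sum_univ_three]; ring
    · simp [swapSum, hiso.apply_succ, Fin.sum_univ_three]; ring
  have hfinal := optimality_bound hsepT hp0 (by linarith : p ≤ 2 * d) hk1' hmh hk3' hK'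
  have eV : typeTwoError TV (σ ⊗ₖ σ) = d ^ 2 + 2 / 3 * (d * p) +
      1 / 10 * ((p ^ 2 + h) / 2 - 1 / 3 * m) + 1 / 6 * ((p ^ 2 - h) / 2) := by
    rw [typeTwoError, trV, ← Complex.ofReal_re (d ^ 2 + 2 / 3 * (d * p) +
      1 / 10 * ((p ^ 2 + h) / 2 - 1 / 3 * m) + 1 / 6 * ((p ^ 2 - h) / 2))]
    push_cast
    rfl
  have eT : typeTwoError T (σ ⊗ₖ σ) = d ^ 2 +
      (inBell T (0, 1) (0, 1) + inBell T (1, 0) (1, 0)).re * (d * p) +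
      (inBell T (1, 1) (2, 2)).re * m + (inBell T (1, 2) (1, 2)).re * p ^ 2 +
      (inBell T (1, 2) (2, 1)).re * h := by
    rw [typeTwoError, trT]
    simp only [← Complex.ofReal_pow, ← Complex.ofReal_mul, Complex.add_re, Complex.re_mul_ofReal,
      Complex.ofReal_re]
  rw [eV, eT]
  exact hfinal

/-! ### The structure of the optimal test -/

/-- The product of `M` with the exchange of the two samples, which acts first. -/
def withSwap {ι : Type*} (M : Matrix (ι × ι) (ι × ι) ℂ) : Matrix (ι × ι) (ι × ι) ℂ :=
  M.submatrix id Prod.swap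

/-- The projection onto the orthogonal complement of `φ⁰`. -/
def complProj : Matrix Pair Pair ℂ := ∑ i : Fin 3, ketbra (bell i.succ)

/-- The vector `e^{11} + e^{22} + e^{33}`. -/
def traceVec : TwoPairs → ℂ := ∑ i : Fin 3, e i.succ i.succ

lemma ketbra_smul {ι : Type*} (r : ℂ) (v : ι → ℂ) : ketbra (r • v) = (r * star r) • ketbra v := by
  ext p q
  simp [ketbra, Matrix.vecMulVec_apply]
  ring

lemma ketbra_eSym (i j : Fin 4) : ketbra (eSym i j) = (1 / 2 : ℂ) •
    (ketbra (e i j) + ketbra (e j i) + withSwap (ketbra (e i j)) + withSwap (ketbra (e j i))) := by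
  rw [eSym, ketbra_smul, star_inv_sqrt, inv_sqrt_two_mul_self]
  congr 1
  ext p q
  simp [ketbra, Matrix.vecMulVec_apply, withSwap, e]
  ring

lemma ketbra_eAlt (i j : Fin 4) : ketbra (eAlt i j) = (1 / 2 : ℂ) •
    (ketbra (e i j) + ketbra (e j i) - withSwap (ketbra (e i j)) - withSwap (ketbra (e j i))) := by
  rw [eAlt, ketbra_smul, star_inv_sqrt, inv_sqrt_two_mul_self]
  congr 1
  ext p q
  simp [ketbra, Matrix.vecMulVec_apply, withSwap, e]
  ring

lemma withSwap_add {ι : Type*} (M N : Matrix (ι × ι) (ι × ι) ℂ) :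
    withSwap (M + N) = withSwap M + withSwap N := rfl

lemma withSwap_ketbra_e_self (i : Fin 4) : withSwap (ketbra (e i i)) = ketbra (e i i) := by
  ext p q
  simp only [ketbra, withSwap, Matrix.submatrix_apply, Matrix.vecMulVec_apply, e, Pi.star_apply,
    Prod.fst_swap, Prod.snd_swap, star_mul', id]
  ring

theorem TV_eq : TV = ketbra (bell 0) ⊗ₖ ketbra (bell 0) +
    (1 / 3 : ℂ) • (ketbra (bell 0) ⊗ₖ complProj + complProj ⊗ₖ ketbra (bell 0)) +
    (2 / 15 : ℂ) • (complProj ⊗ₖ complProj) - (1 / 30 : ℂ) • withSwap (complProj ⊗ₖ complProj) -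
    (1 / 30 : ℂ) • ketbra traceVec := by
  have hK : K1plus = (1 / 3 : ℂ) • ketbra traceVec := by
    rw [K1plus, ketbra_smul, star_inv_sqrt, inv_sqrt_three_mul_self, traceVec, Fin.sum_univ_three]
    rfl
  have hc : complProj = ketbra (bell 1) + ketbra (bell 2) + ketbra (bell 3) := by
    rw [complProj, Fin.sum_univ_three]
    rfl
  simp only [TV, K5plus, hK, K6plus, L3plus, K3minus, L3minus, ketbra_eSym, ketbra_eAlt, hc,
    Matrix.add_kronecker, Matrix.kronecker_add, ← ketbra_e, withSwap_add, withSwap_ketbra_e_self]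
  module

lemma ketbra_bell_zero_add_complProj : ketbra (bell 0) + complProj = 1 := by
  rw [complProj, ← Fin.sum_univ_succ (fun i => ketbra (bell i)), ← bellMatrix_coisometry]
  ext p q
  simp [Matrix.sum_apply, Matrix.mul_apply, ketbra, Matrix.vecMulVec_apply, bellMatrix]

lemma pullback_kronecker {m n m' n' : Type*} [Fintype m] [Fintype m']
    (R : Matrix m n ℂ) (S : Matrix m' n' ℂ) (M : Matrix m m ℂ) (N : Matrix m' m' ℂ) :
    pullback (R ⊗ₖ S) (M ⊗ₖ N) = pullback R M ⊗ₖ pullback S N := by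
  simp only [pullback, Matrix.conjTranspose_kronecker, ← Matrix.mul_kronecker_mul]

lemma pullback_withSwap {m n : Type*} [Fintype m] (R : Matrix m n ℂ)
    (M : Matrix (m × m) (m × m) ℂ) :
    pullback (R ⊗ₖ R) (withSwap M) = withSwap (pullback (R ⊗ₖ R) M) := by
  have h : (R ⊗ₖ R).submatrix Prod.swap Prod.swap = R ⊗ₖ R := by
    ext p q
    simp [mul_comm]
  rw [pullback, pullback, withSwap, withSwap]
  conv_lhs => rw [← h]
  rw [h]
  ext p q
  simp only [Matrix.mul_apply, Matrix.submatrix_apply, id]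
  rw [← (Equiv.prodComm m m).sum_comp]
  refine Finset.sum_congr rfl fun x _ => ?_
  congr 1
  simp [mul_comm]

lemma pullback_sub {m n : Type*} [Fintype m] (R : Matrix m n ℂ) (S T : Matrix m m ℂ) :
    pullback R (S - T) = pullback R S - pullback R T := by
  simp [pullback, Matrix.mul_sub, Matrix.sub_mul]

/-- The vector `∑ᵢ e^{ii}`, including `i = 0`, is the tensor product of two singlets, one on
`A₁ ⊗ A₂` and one on `B₁ ⊗ B₂`. -/
lemma traceVec_add_e_zero (p : TwoPairs) : traceVec p + e 0 0 p =
    (!![0, 1; -1, 0] : Matrix (Fin 2) (Fin 2) ℂ) p.1.1 p.2.1 *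
      (!![0, 1; -1, 0] : Matrix (Fin 2) (Fin 2) ℂ) p.1.2 p.2.2 := by
  have hb : ∀ (i : Fin 4) (p : Pair), bell i p =
      ((Real.sqrt 2 : ℝ) : ℂ)⁻¹ * bellMatrixScaled p i := fun i p =>
    congrFun (congrFun bellMatrix_eq p) i
  have h2 := inv_sqrt_two_mul_self
  have hI := Complex.I_mul_I
  simp only [traceVec, e, Finset.sum_apply, Fin.sum_univ_three, hb]
  generalize ((Real.sqrt 2 : ℝ) : ℂ)⁻¹ = r at h2
  obtain ⟨⟨a, b⟩, c, d⟩ := p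
  fin_cases a <;> fin_cases b <;> fin_cases c <;> fin_cases d <;>
    simp [bellMatrixScaled] <;> grind

/-- The symmetries of the test: unitaries of one sample that fix `φ⁰` and, applied to both
samples, fix `∑ᵢ e^{ii}`. -/
theorem pullback_TV {U : Matrix Pair Pair ℂ} (hU : Uᴴ * U = 1) (h0 : Uᴴ *ᵥ bell 0 = bell 0)
    (ht : (U ⊗ₖ U)ᴴ *ᵥ (traceVec + e 0 0) = traceVec + e 0 0) :
    pullback (U ⊗ₖ U) TV = TV := by
  have hP : pullback U (ketbra (bell 0)) = ketbra (bell 0) := by rw [pullback_ketbra, h0]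
  have hQ : pullback U complProj = complProj := by
    rw [eq_sub_of_add_eq' ketbra_bell_zero_add_complProj, pullback_sub, hP]
    simp [pullback, hU]
  have he : (U ⊗ₖ U)ᴴ *ᵥ e 0 0 = e 0 0 := by
    ext p
    conv_rhs => rw [e, ← h0]
    simp only [Matrix.mulVec, dotProduct, Matrix.conjTranspose_kronecker,
      Matrix.kroneckerMap_apply, Fintype.sum_prod_type (α₁ := Pair), Finset.sum_mul_sum, e]
    exact Finset.sum_congr rfl fun p _ => Finset.sum_congr rfl fun q _ => by ring
  have hw : (U ⊗ₖ U)ᴴ *ᵥ traceVec = traceVec := by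
    rw [Matrix.mulVec_add, he] at ht
    exact add_right_cancel ht
  rw [TV_eq]
  simp only [pullback_sub, pullback_add, pullback_smul, pullback_withSwap, pullback_kronecker, hP,
    hQ, pullback_ketbra, hw]

theorem isVInvariant_TV : IsVInvariant TV := by
  intro g hg
  have hgg := mul_conjTranspose_of_mem_specialUnitaryGroup hg
  have hdet := (Matrix.mem_specialUnitaryGroup_iff.1 hg).2
  have hgg' : gᴴ * g = 1 := mul_eq_one_comm.1 hgg
  refine pullback_TV (U := g ⊗ₖ g.map star) ?_ ?_ ?_
  · rw [Matrix.conjTranspose_kronecker, ← Matrix.mul_kronecker_mul, hgg',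
      mul_eq_one_comm.1 (map_star_mul_conjTranspose hgg), Matrix.one_kronecker_one]
  · have h := fun i j => congrFun (congrFun hgg' i) j
    simp only [Matrix.mul_apply, Fin.sum_univ_two, Matrix.conjTranspose_apply] at h
    ext ⟨a, b⟩
    have h' := h a b
    simp only [Matrix.mulVec, dotProduct, Fintype.sum_prod_type, Fin.sum_univ_two, bell, ket]
    revert h'
    fin_cases a <;> fin_cases b <;> simp <;> intro h' <;>
      linear_combination ((Real.sqrt 2 : ℝ) : ℂ)⁻¹ * h'
  · have hdet' : star g.det = 1 := by rw [hdet, star_one]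
    rw [Matrix.det_fin_two] at hdet hdet'
    ext p
    have key : ((g ⊗ₖ g.map star ⊗ₖ (g ⊗ₖ g.map star))ᴴ *ᵥ (traceVec + e 0 0)) p =
        (g 0 0 * g 1 1 - g 0 1 * g 1 0) * star (g 0 0 * g 1 1 - g 0 1 * g 1 0) *
          (traceVec + e 0 0) p := by
      simp only [Matrix.mulVec, dotProduct, Pi.add_apply, traceVec_add_e_zero,
        Fintype.sum_prod_type, Fin.sum_univ_two]
      obtain ⟨⟨a, b⟩, c, d⟩ := p
      fin_cases a <;> fin_cases b <;> fin_cases c <;> fin_cases d <;> simp <;> ring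
    rw [key, hdet', hdet, one_mul, one_mul]

theorem isABInvariant_TV : IsABInvariant TV := by
  have hd : ∀ i : Fin 4, abTransposition₁ᴴ *ᵥ bell i =
      (![1, -1, -1, -1] : Fin 4 → ℂ) i • bell i := by
    intro i
    ext ⟨a, b⟩
    fin_cases i <;> fin_cases a <;> fin_cases b <;>
      simp [Matrix.mulVec, dotProduct, Fintype.sum_prod_type, abTransposition₁, bell, ket,
        Pi.single_apply]
  rw [IsABInvariant, abTransposition_eq]
  refine pullback_TV ?_ ?_ ?_
  · ext ⟨a, b⟩ ⟨c, d⟩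
    fin_cases a <;> fin_cases b <;> fin_cases c <;> fin_cases d <;>
      simp [Matrix.mul_apply, abTransposition₁]
  · simpa using hd 0
  · have he : ∀ i : Fin 4, (abTransposition₁ ⊗ₖ abTransposition₁)ᴴ *ᵥ e i i = e i i := by
      intro i
      have h1 : (![1, -1, -1, -1] : Fin 4 → ℂ) i * (![1, -1, -1, -1] : Fin 4 → ℂ) i = 1 := by
        fin_cases i <;> simp
      ext p
      have h2 : ∀ p, ((![1, -1, -1, -1] : Fin 4 → ℂ) i • bell i) p =
          (abTransposition₁ᴴ *ᵥ bell i) p := fun p => by rw [hd]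
      simp only [Pi.smul_apply, smul_eq_mul] at h2
      calc _ = (abTransposition₁ᴴ *ᵥ bell i) p.1 * (abTransposition₁ᴴ *ᵥ bell i) p.2 := by
            simp only [Matrix.mulVec, dotProduct, Matrix.conjTranspose_kronecker,
              Matrix.kroneckerMap_apply, Fintype.sum_prod_type (α₁ := Pair), Finset.sum_mul_sum, e]
            exact Finset.sum_congr rfl fun p _ => Finset.sum_congr rfl fun q _ => by ring
        _ = _ := by
            rw [← h2, ← h2, e]
            linear_combination bell i p.1 * bell i p.2 * h1
    simp only [traceVec, Fin.sum_univ_three, Matrix.mulVec_add, he]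

theorem isExchangeInvariant_TV : IsExchangeInvariant TV := by
  have hk : ∀ A B : Matrix Pair Pair ℂ, (A ⊗ₖ B).submatrix Prod.swap Prod.swap = B ⊗ₖ A := by
    intro A B
    ext p q
    simp [mul_comm]
  have hw : (ketbra traceVec).submatrix Prod.swap Prod.swap = ketbra traceVec := by
    have h : ∀ p, traceVec (Prod.swap p) = traceVec p := fun p => by
      simp [traceVec, e, mul_comm]
    ext p q
    simp [ketbra, Matrix.vecMulVec_apply, h]
  have hs : ∀ M : Matrix TwoPairs TwoPairs ℂ, (withSwap M).submatrix Prod.swap Prod.swap =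
      withSwap (M.submatrix Prod.swap Prod.swap) := fun M => rfl
  rw [IsExchangeInvariant, TV_eq]
  simp only [Matrix.submatrix_add, Matrix.submatrix_sub, Matrix.submatrix_smul, Pi.add_apply,
    Pi.sub_apply, Pi.smul_apply, hk, hw, hs]
  rw [add_comm (complProj ⊗ₖ ketbra (bell 0))]

/-! ### A local protocol for the optimal test -/

lemma pullback_pullback {l m n : Type*} [Fintype l] [Fintype m] (R : Matrix m n ℂ)
    (S : Matrix l m ℂ) (M : Matrix l l ℂ) : pullback R (pullback S M) = pullback (S * R) M := by
  simp [pullback, Matrix.mul_assoc]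

/-- The four qubits are measured one after the other, with Kraus operators independent of the
previous outcomes, and the test accepts if the two qubits of each sample give equal outcomes. -/
lemma isLocal_of_equal_outcomes (K₁ K₂ K₃ K₄ : Fin 2 → Matrix (Fin 2) (Fin 2) ℂ)
    (h₁ : ∑ i, (K₁ i)ᴴ * K₁ i = 1) (h₂ : ∑ i, (K₂ i)ᴴ * K₂ i = 1)
    (h₃ : ∑ i, (K₃ i)ᴴ * K₃ i = 1) (h₄ : ∑ i, (K₄ i)ᴴ * K₄ i = 1) :
    IsLocal ((∑ i, ((K₁ i)ᴴ * K₁ i) ⊗ₖ ((K₂ i)ᴴ * K₂ i)) ⊗ₖ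
      (∑ k, ((K₃ k)ᴴ * K₃ k) ⊗ₖ ((K₄ k)ᴴ * K₄ k))) := by
  have h := LOCC.roundA₁ K₁ h₁ _ _ fun i => LOCC.roundB₁ K₂ h₂ _ _ fun j =>
    LOCC.roundA₂ K₃ h₃ _ _ fun k => LOCC.roundB₂ K₄ h₄
      (fun l => if i = j ∧ k = l then (1 : Op 2 2 2 2 2 2 2 2) else 0)
      (fun l => if i = j ∧ k = l then (0 : Op 2 2 2 2 2 2 2 2) else 1) fun l => by
        split_ifs
        · exact LOCC.accept 2 2 2 2
        · exact LOCC.reject 2 2 2 2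
  convert h.isLocal using 1
  have hprod : ∀ i j k l, onB₂ 2 2 2 (K₄ l) * onA₂ 2 2 2 (K₃ k) * onB₁ 2 2 2 (K₂ j) *
      onA₁ 2 2 2 (K₁ i) = (K₁ i ⊗ₖ K₂ j) ⊗ₖ (K₃ k ⊗ₖ K₄ l) := fun i j k l => by
    simp only [onA₁, onB₁, onA₂, onB₂, ← Matrix.mul_kronecker_mul, ← Matrix.one_kronecker_one,
      Matrix.one_mul, Matrix.mul_one]
  have hone : ∀ i j k l, pullback ((K₁ i ⊗ₖ K₂ j) ⊗ₖ (K₃ k ⊗ₖ K₄ l))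
      (1 : Op 2 2 2 2 2 2 2 2) = (((K₁ i)ᴴ * K₁ i) ⊗ₖ ((K₂ j)ᴴ * K₂ j)) ⊗ₖ
        (((K₃ k)ᴴ * K₃ k) ⊗ₖ ((K₄ l)ᴴ * K₄ l)) := fun i j k l => by
    simp only [pullback, Matrix.mul_one, Matrix.conjTranspose_kronecker,
      ← Matrix.mul_kronecker_mul]
  simp only [pullback_sum, pullback_pullback, hprod]
  simp only [apply_ite (pullback _), hone, pullback_zero, Fin.sum_univ_two]
  simp [Matrix.add_kronecker, Matrix.kronecker_add]
  abel

/-- The effect on one sample that accepts `φ⁰` and the Bell vector in direction `n`. For a unit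
vector `n` it is the event that measurements of the two qubits along corresponding axes of the
Bloch sphere agree. -/
def axisEffect (n : Fin 3 → ℝ) : Matrix Pair Pair ℂ :=
  ketbra (bell 0) + ketbra (∑ i, (n i : ℂ) • bell i.succ)

/-- The projections `(1 ± N) / 2` of a qubit onto the two ends of the axis `n`. The coordinates
are those of the Bell basis, in which `N = n₀ σ_x - n₁ σ_y + n₂ σ_z`. -/
def axisProj (n : Fin 3 → ℝ) (s : Fin 2) : Matrix (Fin 2) (Fin 2) ℂ :=
  (1 / 2 : ℂ) • (1 + (-1) ^ s.val • !![(n 2 : ℂ), n 0 + n 1 * Complex.I;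
    n 0 - n 1 * Complex.I, -n 2])

lemma axisProj_conjTranspose (n : Fin 3 → ℝ) (s : Fin 2) : (axisProj n s)ᴴ = axisProj n s := by
  ext i j
  fin_cases s <;> fin_cases i <;> fin_cases j <;> simp [axisProj] <;> ring

lemma axisProj_mul_self {n : Fin 3 → ℝ} (hn : ∑ i, n i ^ 2 = 1) (s : Fin 2) :
    axisProj n s * axisProj n s = axisProj n s := by
  have h : (n 0 : ℂ) ^ 2 + n 1 ^ 2 + n 2 ^ 2 = 1 := by
    rw [Fin.sum_univ_three] at hn
    exact_mod_cast hn
  have hI := Complex.I_sq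
  ext i j
  fin_cases s <;> fin_cases i <;> fin_cases j <;>
    simp [axisProj, Matrix.mul_apply, Fin.sum_univ_two] <;> grind

lemma sum_axisProj (n : Fin 3 → ℝ) : ∑ s, axisProj n s = 1 := by
  ext i j
  fin_cases i <;> fin_cases j <;> simp [axisProj] <;> ring

lemma sum_axisProj_kronecker {n : Fin 3 → ℝ} (hn : ∑ i, n i ^ 2 = 1) :
    ∑ s, axisProj n s ⊗ₖ (axisProj n s).map star = axisEffect n := by
  have h : (n 0 : ℂ) ^ 2 + n 1 ^ 2 + n 2 ^ 2 = 1 := by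
    rw [Fin.sum_univ_three] at hn
    exact_mod_cast hn
  have hI := Complex.I_sq
  have hb : ∀ (i : Fin 4) (p : Pair), bell i p =
      ((Real.sqrt 2 : ℝ) : ℂ)⁻¹ * bellMatrixScaled p i := fun i p =>
    congrFun (congrFun bellMatrix_eq p) i
  have h2 := inv_sqrt_two_mul_self
  ext p q
  simp only [axisEffect, ketbra, Matrix.add_apply, Matrix.vecMulVec_apply, Pi.star_apply,
    Pi.add_apply, Pi.smul_apply, smul_eq_mul, Fin.sum_univ_three, hb, star_add,
    star_mul', star_inv_sqrt]
  clear hb hn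
  have hc : (starRingEnd ℂ) 2 = 2 := map_ofNat _ _
  generalize ((Real.sqrt 2 : ℝ) : ℂ)⁻¹ = r at h2
  obtain ⟨a, b⟩ := p
  obtain ⟨c, d⟩ := q
  fin_cases a <;> fin_cases b <;> fin_cases c <;> fin_cases d <;>
    simp [bellMatrixScaled, axisProj, hc] <;> grind

lemma isLocal_axisEffect {n n' : Fin 3 → ℝ} (hn : ∑ i, n i ^ 2 = 1) (hn' : ∑ i, n' i ^ 2 = 1) :
    IsLocal (axisEffect n ⊗ₖ axisEffect n') := by
  have hP : ∀ {n : Fin 3 → ℝ}, ∑ i, n i ^ 2 = 1 → ∀ s,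
      (axisProj n s)ᴴ * axisProj n s = axisProj n s := fun hn s => by
    rw [axisProj_conjTranspose, axisProj_mul_self hn]
  have hP' : ∀ {n : Fin 3 → ℝ}, ∑ i, n i ^ 2 = 1 → ∀ s,
      ((axisProj n s).map star)ᴴ * (axisProj n s).map star = (axisProj n s).map star := by
    intro n hn s
    ext i j
    have h := congrArg (starRingEnd ℂ) (congrFun (congrFun (hP hn s) i) j)
    simpa [Matrix.mul_apply] using h
  have hS : ∀ n : Fin 3 → ℝ, ∑ s, (axisProj n s).map star = 1 := by
    intro n
    ext i j
    have h := congrArg (starRingEnd ℂ) (congrFun (congrFun (sum_axisProj n) i) j)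
    simpa [Matrix.one_apply, apply_ite] using h
  have h := isLocal_of_equal_outcomes (axisProj n) (fun s => (axisProj n s).map star)
    (axisProj n') (fun s => (axisProj n' s).map star)
    (by simp only [hP hn, sum_axisProj]) (by simp only [hP' hn, hS])
    (by simp only [hP hn', sum_axisProj]) (by simp only [hP' hn', hS])
  simpa only [hP hn, hP' hn, hP hn', hP' hn', sum_axisProj_kronecker hn,
    sum_axisProj_kronecker hn'] using h

/-! ### A finite design of orthogonal axes -/

/-- Directions for the first sample: coordinate axes and face diagonals of the cube. -/
def dirOne : Fin 12 → Fin 3 → ℤ :=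
  ![![1, 0, 0], ![1, 0, 0], ![0, 1, 0], ![0, 1, 0], ![0, 0, 1], ![0, 0, 1],
    ![1, 1, 0], ![1, -1, 0], ![0, 1, 1], ![0, 1, -1], ![1, 0, 1], ![1, 0, -1]]

/-- Directions for the second sample, orthogonal to those for the first. -/
def dirTwo : Fin 12 → Fin 3 → ℤ :=
  ![![0, 1, 0], ![0, 0, 1], ![1, 0, 0], ![0, 0, 1], ![1, 0, 0], ![0, 1, 0],
    ![1, -1, 0], ![1, 1, 0], ![0, 1, -1], ![0, 1, 1], ![1, 0, -1], ![1, 0, 1]]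

/-- The squared length of the direction vectors. -/
def dirSq (c : Fin 12) : ℕ := if c < 6 then 1 else 2

/-- The probability of each pair of axes. -/
def dirProb (c : Fin 12) : ℝ := if c < 6 then 1 / 10 else 1 / 15

/-- The unit vector in direction `u`. -/
def unitDir (u : Fin 12 → Fin 3 → ℤ) (c : Fin 12) (i : Fin 3) : ℝ :=
  u c i / Real.sqrt (dirSq c)

lemma unitDir_mul (u : Fin 12 → Fin 3 → ℤ) (c : Fin 12) (i j : Fin 3) :
    unitDir u c i * unitDir u c j = u c i * u c j / dirSq c := by
  rw [unitDir, unitDir, div_mul_div_comm, Real.mul_self_sqrt (Nat.cast_nonneg _)]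

lemma sum_sq_unitDir (u : Fin 12 → Fin 3 → ℤ) (hu : ∀ c, ∑ i, u c i * u c i = dirSq c)
    (c : Fin 12) : ∑ i, unitDir u c i ^ 2 = 1 := by
  have h0 : (dirSq c : ℝ) ≠ 0 := by
    have : ∀ c, dirSq c ≠ 0 := by decide
    exact_mod_cast this c
  simp only [sq, unitDir_mul]
  rw [← Finset.sum_div, div_eq_one_iff_eq h0]
  exact_mod_cast hu c

lemma sum_dirProb : ∑ c, dirProb c = 1 := by
  simp [Fin.sum_univ_succ, dirProb, Fin.lt_def]
  norm_num

/-- The second moments of the design are isotropic. -/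
lemma design_second_moment (u : Fin 12 → Fin 3 → ℤ)
    (hu : ∀ i j, ∑ c, (if c < 6 then 3 else 1) * (u c i * u c j) = if i = j then 10 else 0)
    (i j : Fin 3) :
    ∑ c, dirProb c * (unitDir u c i * unitDir u c j) = if i = j then 1 / 3 else 0 := by
  have h : ∀ c, dirProb c * (unitDir u c i * unitDir u c j) =
      (((if c < 6 then 3 else 1) * (u c i * u c j) : ℤ) : ℝ) / 30 := by
    intro c
    rw [unitDir_mul, dirProb, dirSq]
    split_ifs <;> push_cast <;> ring
  simp only [h]
  rw [← Finset.sum_div, ← Int.cast_sum, hu]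
  split_ifs <;> norm_num

/-- The mixed fourth moments of the design agree with those of a uniformly random pair of
orthogonal axes. -/
lemma design_fourth_moment (i j k l : Fin 3) :
    ∑ c, dirProb c * (unitDir dirOne c i * unitDir dirOne c k *
      (unitDir dirTwo c j * unitDir dirTwo c l)) =
      (2 / 15) * (if i = k ∧ j = l then 1 else 0) - (1 / 30) * (if i = l ∧ j = k then 1 else 0) -
        (1 / 30) * (if i = j ∧ k = l then 1 else 0) := by
  have hint : ∀ i j k l, ∑ c, (if c < 6 then 6 else 1) *
      (dirOne c i * dirOne c k * (dirTwo c j * dirTwo c l)) =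
      8 * (if i = k ∧ j = l then 1 else 0) - 2 * (if i = l ∧ j = k then 1 else 0) -
        2 * (if i = j ∧ k = l then 1 else 0) := by decide +kernel
  have h : ∀ c, dirProb c * (unitDir dirOne c i * unitDir dirOne c k *
      (unitDir dirTwo c j * unitDir dirTwo c l)) = (((if c < 6 then 6 else 1) *
      (dirOne c i * dirOne c k * (dirTwo c j * dirTwo c l)) : ℤ) : ℝ) / 60 := by
    intro c
    rw [unitDir_mul, unitDir_mul, dirProb, dirSq]
    split_ifs <;> push_cast <;> ring
  simp only [h]
  rw [← Finset.sum_div, ← Int.cast_sum, hint]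
  push_cast
  ring

lemma pullback_ketbra_bell_zero : pullback bellMatrix (ketbra (bell 0)) =
    Matrix.of (Fin.cons (Fin.cons 1 0) fun _ => Fin.cons 0 0) := by
  rw [pullback_ketbra, bellMatrix_conjTranspose_mulVec_bell]
  ext i j
  induction i using Fin.cases <;> induction j using Fin.cases <;>
    simp [ketbra, Matrix.vecMulVec_apply]

lemma pullback_axisEffect (n : Fin 3 → ℝ) : pullback bellMatrix (axisEffect n) =
    Matrix.of (Fin.cons (Fin.cons 1 0) fun i => Fin.cons 0 fun j => ((n i * n j : ℝ) : ℂ)) := by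
  have hv : bellMatrixᴴ *ᵥ (∑ i, (n i : ℂ) • bell i.succ) =
      (Fin.cons 0 fun i => (n i : ℂ) : Fin 4 → ℂ) := by
    simp only [Matrix.mulVec_sum, Matrix.mulVec_smul, bellMatrix_conjTranspose_mulVec_bell]
    ext i
    induction i using Fin.cases <;> simp [Finset.sum_apply, Pi.single_apply]
  rw [axisEffect, pullback_add, pullback_ketbra_bell_zero, pullback_ketbra, hv]
  ext i j
  induction i using Fin.cases <;> induction j using Fin.cases <;>
    simp [ketbra, Matrix.vecMulVec_apply]

lemma pullback_complProj : pullback bellMatrix complProj =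
    Matrix.of (Fin.cons 0 fun i => Fin.cons 0 fun j => if i = j then 1 else 0) := by
  rw [eq_sub_of_add_eq' ketbra_bell_zero_add_complProj, pullback_sub, pullback_ketbra_bell_zero,
    pullback, Matrix.mul_one, bellMatrix_isometry]
  ext i j
  induction i using Fin.cases <;> induction j using Fin.cases <;>
    simp [Matrix.one_apply, (Fin.succ_ne_zero _).symm]

lemma bellMatrix₂_conjTranspose_mulVec_traceVec (i j : Fin 4) :
    (bellMatrix₂ᴴ *ᵥ traceVec) (i, j) =
      (Fin.cons 0 fun i => Fin.cons 0 fun j => if i = j then 1 else 0 : Fin 4 → Fin 4 → ℂ) i j := by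
  simp only [traceVec, Matrix.mulVec_sum, bellMatrix₂_conjTranspose_mulVec_e]
  induction i using Fin.cases <;> induction j using Fin.cases <;>
    simp [Finset.sum_apply, Pi.single_apply, (Fin.succ_ne_zero _).symm, ite_and, eq_comm]

/-- The optimal test is a finite mixture of pairs of axis measurements. -/
theorem TV_eq_sum : TV = ∑ c, (dirProb c : ℂ) •
    (axisEffect (unitDir dirOne c) ⊗ₖ axisEffect (unitDir dirTwo c)) := by
  have m0 : ∑ c, (dirProb c : ℂ) = 1 := by
    rw [← Complex.ofReal_sum, sum_dirProb, Complex.ofReal_one]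
  have m2 : ∀ i j, ∑ c, (dirProb c : ℂ) * (unitDir dirOne c i * unitDir dirOne c j) =
      if i = j then 1 / 3 else 0 := fun i j => by
    have h := congrArg (fun x : ℝ => (x : ℂ)) (design_second_moment dirOne (by decide) i j)
    push_cast at h
    refine h.trans ?_
    split_ifs <;> simp
  have m2' : ∀ i j, ∑ c, (dirProb c : ℂ) * (unitDir dirTwo c i * unitDir dirTwo c j) =
      if i = j then 1 / 3 else 0 := fun i j => by
    have h := congrArg (fun x : ℝ => (x : ℂ)) (design_second_moment dirTwo (by decide) i j)
    push_cast at h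
    refine h.trans ?_
    split_ifs <;> simp
  have m4 : ∀ i j k l, ∑ c, (dirProb c : ℂ) * (unitDir dirOne c i * unitDir dirOne c k *
      (unitDir dirTwo c j * unitDir dirTwo c l)) =
      (2 / 15) * (if i = k ∧ j = l then 1 else 0) - (1 / 30) * (if i = l ∧ j = k then 1 else 0) -
        (1 / 30) * (if i = j ∧ k = l then 1 else 0) := fun i j k l => by
    have h := congrArg (fun x : ℝ => (x : ℂ)) (design_fourth_moment i j k l)
    push_cast at h
    refine h.trans ?_
    split_ifs <;> simp
  apply inBell_injective
  ext ⟨i, j⟩ ⟨k, l⟩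
  have hsum : inBell (∑ c, (dirProb c : ℂ) •
      (axisEffect (unitDir dirOne c) ⊗ₖ axisEffect (unitDir dirTwo c))) (i, j) (k, l) =
      ∑ c, (dirProb c : ℂ) * (pullback bellMatrix (axisEffect (unitDir dirOne c)) i k *
        pullback bellMatrix (axisEffect (unitDir dirTwo c)) j l) := by
    rw [inBell, pullback_sum, Matrix.sum_apply]
    refine Finset.sum_congr rfl fun c _ => ?_
    rw [pullback_smul, bellMatrix₂, pullback_kronecker]
    rfl
  have hket : pullback (bellMatrix ⊗ₖ bellMatrix) (ketbra traceVec) (i, j) (k, l) =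
      (bellMatrix₂ᴴ *ᵥ traceVec) (i, j) * star ((bellMatrix₂ᴴ *ᵥ traceVec) (k, l)) := by
    rw [pullback_ketbra]
    rfl
  rw [hsum, TV_eq, inBell, bellMatrix₂]
  simp only [pullback_sub, pullback_add, pullback_smul, pullback_withSwap, pullback_kronecker,
    pullback_axisEffect, pullback_complProj, pullback_ketbra_bell_zero]
  simp only [Matrix.add_apply, Matrix.sub_apply, Matrix.smul_apply, withSwap,
    Matrix.submatrix_apply, Matrix.kroneckerMap_apply, hket,
    bellMatrix₂_conjTranspose_mulVec_traceVec, Matrix.of_apply, Prod.fst_swap, Prod.snd_swap, id,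
    smul_eq_mul]
  induction i using Fin.cases <;> induction j using Fin.cases <;>
    induction k using Fin.cases <;> induction l using Fin.cases <;>
    simp [m0, m2, m2', m4]
  grind

theorem isLocal_TV : IsLocal TV := by
  rw [TV_eq_sum]
  refine IsLocal.convex_sum dirProb (fun c => ?_) sum_dirProb _ fun c => isLocal_axisEffect
    (sum_sq_unitDir dirOne (by decide) c) (sum_sq_unitDir dirTwo (by decide) c)
  rw [dirProb]
  split_ifs <;> norm_num

theorem isLevelZero_TV : IsLevelZero TV := by
  have h1 : (ketbra (bell 0) ⊗ₖ ketbra (bell 0)).trace = 1 := by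
    rw [← ketbra_e, ← trace_inBell, inBell_ketbra, bellMatrix₂_conjTranspose_mulVec_e]
    simp [ketbra]
  have h2 : ((ketbra (bell 0) ⊗ₖ ketbra (bell 0)) * TV).trace = 1 := by
    rw [trace_mul_TV, trace_mul_K6plus, trace_mul_K1plus, trace_mul_K3minus,
      pullback_ketbra_bell_zero]
    simp
  rw [IsLevelZero, typeOneError, Matrix.mul_sub, Matrix.mul_one, Matrix.trace_sub, h1, h2]
  simp

theorem isAdmissible_TV : IsAdmissible TV where
  isTest := isLocal_TV.isTest
  isLocal := isLocal_TV
  vInvariant := isVInvariant_TV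
  abInvariant := isABInvariant_TV
  levelZero := isLevelZero_TV

end LOCCDetection

end

theorem theorem4 :
    ∃ θ₀ : ℝ, θ₀ < 1 ∧
      LOCCDetection.IsUMP LOCCDetection.IsAdmissible
        (LOCCDetection.stateSet θ₀ \ {LOCCDetection.ketbra (LOCCDetection.bell 0)})
        LOCCDetection.TV ∧
      LOCCDetection.IsExchangeInvariant LOCCDetection.TV :=
  ⟨1 / 3, by norm_num, ⟨LOCCDetection.isAdmissible_TV, fun _ hσ _ hT =>
    LOCCDetection.typeTwoError_TV_le hσ.1 hT⟩, LOCCDetection.isExchangeInvariant_TV⟩
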